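/- All Hilbert spaces are finite dimensional and nonzero, with fixed orthonormal bases; $\mathcal C(X,Y)$ denotes the quantum channels (completely positive trace preserving maps) from operators on $X$ to operators on $Y$, and $\Phi^*$ the adjoint of $\Phi$, $\mathrm{Tr}[X\Phi^*(Y)]=\mathrm{Tr}[\Phi(X)Y]$. Tensor signs are suppressed and the order of tensor factors is disregarded. **Setting.** Let a class of admissible input-output spaces $R=R_0R_1$ and a class of ancillas, containing the trivial space $1$ and closed under tensor products, be given. Let $\mathcal C_{\mathrm{pre}}(S_0,UR_0)\subseteq\mathcal C(S_0,UR_0)$ and $\mathcal C_{\mathrm{post}}(UR_1,S_1)\subseteq\mathcal C(UR_1,S_1)$ ($R,S$ admissible, $U$ an ancilla) be families of channels such that, for all admissible $R,S,T$ and ancillas $U,V$: (a) $id_{R_0}\in\mathcal C_{\mathrm{pre}}(R_0,R_0)$ and $id_{R_1}\in\mathcal C_{\mathrm{post}}(R_1,R_1)$; (b) if $\alpha\in\mathcal C_{\mathrm{pre}}(S_0,UR_0)$ and $\alpha'\in\mathcal C_{\mathrm{pre}}(T_0,VS_0)$, then $(id_V\otimes\alpha)\circ\alpha'\in\mathcal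 C_{\mathrm{pre}}(T_0,VUR_0)$; if $\beta\in\mathcal C_{\mathrm{post}}(UR_1,S_1)$ and $\beta'\in\mathcal C_{\mathrm{post}}(VS_1,T_1)$, then $\beta'\circ(id_V\otimes\beta)\in\mathcal C_{\mathrm{post}}(VUR_1,T_1)$; (c) the set $\mathsf F(R,S)$ of all superchannels $\alpha*\beta:\Phi\mapsto\beta\circ(id_U\otimes\Phi)\circ\alpha$, with $U$ an ancilla, $\alpha\in\mathcal C_{\mathrm{pre}}(S_0,UR_0)$ and $\beta\in\mathcal C_{\mathrm{post}}(UR_1,S_1)$, is convex. Write $\mathsf F=\mathcal C_{\mathrm{pre}}*\mathcal C_{\mathrm{post}}$. For $\Phi_1\in\mathcal C(A_0,A_1)$ and $\Phi_2\in\mathcal C(A_0',A_1')$, with $A,A'$ admissible, let $$\delta_{\mathsf F}(\Phi_1\|\Phi_2)=\inf_{\Theta\in\mathsf F(A,A')}\|\Theta(\Phi_1)-\Phi_2\|_\diamond,\qquad \|\Psi\|_\diamond=\max_{\rho}\|(\Psi\otimes id)(\rho)\|_1,$$ where $\rho$ runs over the states on two copies of the input space of $\Psi$. Let $\mathcal M_{\mathrm{post}}$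 be a family of sets $\mathcal M_{\mathrm{post}}(VS_1T_1)$ of measurements (POVMs with finitely many outcomes) on $VS_1T_1$ ($S,T$ admissible, $V$ an ancilla) that is closed under preprocessings by $\mathcal C_{\mathrm{post}}$: if $\beta\in\mathcal C_{\mathrm{post}}(UR_1,S_1)$ and $M\in\mathcal M_{\mathrm{post}}(VS_1T_1)$, then $(id_{VT_1}\otimes\beta^*)(M)\in\mathcal M_{\mathrm{post}}(VUR_1T_1)$. For an ensemble $\mathcal E=\{\lambda_i,\rho_i\}_{i=1}^k$ of states with prior probabilities and a measurement $M=\{M_i\}_{i=1}^k$, let $P_{\mathrm{succ}}(\mathcal E,M)=\sum_i\lambda_i\mathrm{Tr}[\rho_iM_i]$ and $P_{\mathrm{succ}}(\mathcal E)=\max_MP_{\mathrm{succ}}(\mathcal E,M)$. For $R$ admissible, $\mathcal E$ an ensemble on $R_0R_1$ and $\Phi\in\mathcal C(A_0'',A_1'')$ with $A''$ admissible, let $$P_{\mathrm{succ}}^{\mathcal C_{\mathrm{pre}}(R_0,\cdot A_0''),\Phi,\mathcal M_{\mathrm{post}}}(\mathcal E)=\sup_{U,\ \alpha\in\mathcal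 C_{\mathrm{pre}}(R_0,UA_0''),\ M\in\mathcal M_{\mathrm{post}}(UA_1''R_1)}P_{\mathrm{succ}}\big((\alpha\otimes id_{R_1})(\mathcal E),(id_U\otimes\Phi^*\otimes id_{R_1})(M)\big),$$ over the measurements $M$ with as many outcomes as $\mathcal E$ has elements. Infima and suprema are taken in $[-\infty,\infty]$, with $\inf\emptyset=\infty$ and $\sup\emptyset=-\infty$. **Theorem 4.** Let $\epsilon\ge0$. If $\delta_{\mathsf F}(\Phi_1\|\Phi_2)\le\epsilon$, then for every admissible $R=R_0R_1$ and every ensemble $\mathcal E$ on $R_0R_1$, $$P_{\mathrm{succ}}^{\mathcal C_{\mathrm{pre}}(R_0,\cdot A_0'),\Phi_2,\mathcal M_{\mathrm{post}}}(\mathcal E)\le P_{\mathrm{succ}}^{\mathcal C_{\mathrm{pre}}(R_0,\cdot A_0),\Phi_1,\mathcal M_{\mathrm{post}}}(\mathcal E)+\frac\epsilon2P_{\mathrm{succ}}(\mathcal E).\qquad(*)$$ Conversely, let $d=\dim A_1'$ and let $U_1,\dots,U_{d^2}$ be generalized Pauli unitaries on $A_1'$, that is, unitaries that are pairwise orthogonal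 in the Hilbert-Schmidt inner product. Let $\psi=d^{-1}\sum_{i,j}|ii\rangle\langle jj|$ be the maximally entangled state on $A_1'A_1'$ and let $\mathsf B_x=(U_x\otimes I)\psi(U_x\otimes I)^*$, $x=1,\dots,d^2$, be the Bell measurement. For a measurement $M$ with $d^2$ outcomes on $UA_1A_1'$, let $\beta^M\in\mathcal C(UA_1,A_1')$ be the channel of the teleportation scheme, $$\beta^M(\sigma)=\sum_xU_x\,\mathrm{Tr}_{UA_1\tilde A}\big[(\sigma\otimes\psi_{\tilde AA_1'})(M_x\otimes I_{A_1'})\big]U_x^*,$$ where $\tilde A$ is a copy of $A_1'$ and $M$ is seen as a measurement on $UA_1\tilde A$. If $\mathsf B\in\mathcal M_{\mathrm{post}}(A_1'A_1')$, and $\beta^M\in\mathcal C_{\mathrm{post}}(UA_1,A_1')$ for every ancilla $U$ and every $M\in\mathcal M_{\mathrm{post}}(UA_1A_1')$ with $d^2$ outcomes, and if $(*)$ holds with $R=A'$ for all ensembles $\mathcal E$ on $A_0'A_1'$, then $\delta_{\mathsf F}(\Phi_1\|\Phi_2)\le\epsilon$. -/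

import Mathlib

universe u v w

open scoped Kronecker ComplexOrder

noncomputable section

namespace ChannelComparison

/-! ### States, maps, channels and measurements

A finite dimensional Hilbert space with its standard basis is given by the finite type that indexes
the basis; operators on it are square complex matrices, and tensor products are indexed by
products of types. -/

/-- Linear maps between the operator algebras of two systems. -/
abbrev SMap (A B : Type*) : Type _ := Matrix A A ℂ →ₗ[ℂ] Matrix B B ℂ

/-- The map `Φ ⊗ id_R`. -/
def tensorId {A B : Type*} (R : Type*) (Φ : SMap A B) : SMap (A × R) (B × R) where
  toFun X := Matrix.of fun p q => Φ (Matrix.of fun a a' => X (a, p.2) (a', q.2)) p.1 q.1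
  map_add' X Y := by
    ext p q
    exact congrFun (congrFun (Φ.map_add (Matrix.of fun a a' => X (a, p.2) (a', q.2))
      (Matrix.of fun a a' => Y (a, p.2) (a', q.2))) p.1) q.1
  map_smul' c X := by
    ext p q
    exact congrFun (congrFun (Φ.map_smul c (Matrix.of fun a a' => X (a, p.2) (a', q.2))) p.1) q.1

/-- The map `id_U ⊗ Φ`, as a linear function of `Φ`. -/
def idTensor {A B : Type*} (U : Type*) : SMap A B →ₗ[ℂ] SMap (U × A) (U × B) where
  toFun Φ :=
    { toFun := fun X =>
        Matrix.of fun p q => Φ (Matrix.of fun a a' => X (p.1, a) (q.1, a')) p.2 q.2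
      map_add' := fun X Y => by
        ext p q
        exact congrFun (congrFun (Φ.map_add (Matrix.of fun a a' => X (p.1, a) (q.1, a'))
          (Matrix.of fun a a' => Y (p.1, a) (q.1, a'))) p.2) q.2
      map_smul' := fun c X => by
        ext p q
        exact congrFun (congrFun (Φ.map_smul c (Matrix.of fun a a' => X (p.1, a) (q.1, a')))
          p.2) q.2 }
  map_add' _ _ := rfl
  map_smul' _ _ := rfl

/-- The identification of the operators on two systems whose basis indices are identified. -/
def relabel {A B : Type*} (e : A ≃ B) : SMap A B :=
  (Matrix.reindexLinearEquiv ℂ ℂ e e).toLinearMap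

/-- The adjoint `Φ*`, determined by `Tr [X Φ*(Y)] = Tr [Φ(X) Y]`; see `trace_mul_adjointMap`. -/
def adjointMap {A B : Type*} [Fintype B] [DecidableEq A] (Φ : SMap A B) : SMap B A where
  toFun Y := Matrix.of fun a a' => (Φ (Matrix.single a' a 1) * Y).trace
  map_add' X Y := by
    ext a a'
    simp [Matrix.mul_add]
  map_smul' c X := by
    ext a a'
    simp

theorem trace_mul_adjointMap {A B : Type*} [Fintype A] [Fintype B] [DecidableEq A]
    (Φ : SMap A B) (X : Matrix A A ℂ) (Y : Matrix B B ℂ) :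
    (X * adjointMap Φ Y).trace = (Φ X * Y).trace := by
  conv_rhs => rw [Matrix.matrix_eq_sum_single X]
  have h : ∀ i j, Matrix.single i j (X i j) = X i j • Matrix.single i j (1 : ℂ) := by
    intro i j
    simp
  simp only [h, map_sum, map_smul, Finset.sum_mul, Matrix.trace_sum, Matrix.smul_mul,
    Matrix.trace_smul, smul_eq_mul]
  simp [adjointMap, Matrix.trace, Matrix.mul_apply]

/-- Complete positivity: `Φ ⊗ id` preserves positive semidefiniteness for every ancilla. -/
def IsCompletelyPositive {A B : Type*} (Φ : SMap A B) : Prop :=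
  ∀ (n : ℕ) (X : Matrix (A × Fin n) (A × Fin n) ℂ),
    X.PosSemidef → (tensorId (Fin n) Φ X).PosSemidef

/-- Quantum channels: completely positive trace preserving maps. -/
def IsChannel {A B : Type*} [Fintype A] [Fintype B] (Φ : SMap A B) : Prop :=
  IsCompletelyPositive Φ ∧ ∀ X, (Φ X).trace = X.trace

/-- States: positive semidefinite operators of trace one. -/
def IsState {A : Type*} [Fintype A] (ρ : Matrix A A ℂ) : Prop :=
  ρ.PosSemidef ∧ ρ.trace = 1

/-- Quantum measurements with `k` outcomes. -/
def IsMeasurement {A : Type*} [DecidableEq A] {k : ℕ} (M : Fin k → Matrix A A ℂ) : Prop :=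
  (∀ i, (M i).PosSemidef) ∧ ∑ i, M i = 1

/-- The trace norm `Tr √(X*X)`, the sum of the singular values. -/
def traceNorm {A : Type*} [Fintype A] [DecidableEq A] (X : Matrix A A ℂ) : ℝ :=
  ∑ i, √((Matrix.isHermitian_conjTranspose_mul_self X).eigenvalues i)

/-- The diamond norm. -/
def diamondNorm {A B : Type*} [Fintype A] [DecidableEq A] [Fintype B] [DecidableEq B]
    (Φ : SMap A B) : ℝ :=
  sSup {t | ∃ ρ : Matrix (A × A) (A × A) ℂ, IsState ρ ∧ t = traceNorm (tensorId A Φ ρ)}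

/-! ### Ensembles and success probabilities -/

/-- An ensemble of `k` states with prior probabilities. -/
structure Ensemble (A : Type*) [Fintype A] (k : ℕ) where
  prob : Fin k → ℝ
  state : Fin k → Matrix A A ℂ
  prob_nonneg : ∀ i, 0 ≤ prob i
  sum_prob : ∑ i, prob i = 1
  isState : ∀ i, IsState (state i)

/-- The average probability `∑ i, λ_i Tr [ρ_i M_i]` of guessing correctly. -/
def successProb {A : Type*} [Fintype A] {k : ℕ} (lam : Fin k → ℝ)
    (ρ M : Fin k → Matrix A A ℂ) : ℝ :=
  ∑ i, lam i * ((ρ i * M i).trace).re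

/-- The optimal success probability of an ensemble over all measurements. -/
def Ensemble.optSuccess {A : Type*} [Fintype A] [DecidableEq A] {k : ℕ} (E : Ensemble A k) : ℝ :=
  sSup {p | ∃ M : Fin k → Matrix A A ℂ, IsMeasurement M ∧ p = successProb E.prob E.state M}

/-! ### The Bell measurement and the teleportation scheme -/

/-- The maximally entangled state. -/
def maxEntangled (R : Type*) [Fintype R] [DecidableEq R] : Matrix (R × R) (R × R) ℂ :=
  Matrix.of fun p q => if p.1 = p.2 ∧ q.1 = q.2 then (Fintype.card R : ℂ)⁻¹ else 0

/-- Generalized Pauli unitaries: `d²` unitaries, orthogonal in the Hilbert-Schmidt inner product.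
Both the Heisenberg-Weyl unitaries and their tensor products are of this form. -/
def IsPauliBasis {R : Type*} [Fintype R] [DecidableEq R]
    (W : Fin (Fintype.card R ^ 2) → Matrix R R ℂ) : Prop :=
  (∀ x, W x ∈ Matrix.unitaryGroup R ℂ) ∧ ∀ x y, x ≠ y → ((W x).conjTranspose * W y).trace = 0

/-- The Bell measurement: the maximally entangled state conjugated by `U_x ⊗ 1`. -/
def bell {R : Type*} [Fintype R] [DecidableEq R]
    (W : Fin (Fintype.card R ^ 2) → Matrix R R ℂ) (x : Fin (Fintype.card R ^ 2)) :
    Matrix (R × R) (R × R) ℂ :=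
  (W x ⊗ₖ (1 : Matrix R R ℂ)) * maxEntangled R * (W x ⊗ₖ (1 : Matrix R R ℂ)).conjTranspose

/-- The partial trace over the first tensor factor. -/
def partialTraceFst {A R : Type*} [Fintype A] (X : Matrix (A × R) (A × R) ℂ) : Matrix R R ℂ :=
  Matrix.of fun r r' => ∑ a, X (a, r) (a, r')

/-- The channel obtained from a measurement `M` on `A ⊗ R` in the teleportation scheme:
`σ ↦ ∑ x, U_x Tr_{AR}[(σ ⊗ ψ) (M_x ⊗ 1)] U_x*`. -/
def teleport {A R : Type*} [Fintype A] [Fintype R] [DecidableEq R]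
    (W : Fin (Fintype.card R ^ 2) → Matrix R R ℂ)
    (M : Fin (Fintype.card R ^ 2) → Matrix (A × R) (A × R) ℂ) : SMap A R where
  toFun σ := ∑ x, W x * partialTraceFst
    (relabel (Equiv.prodAssoc A R R).symm (σ ⊗ₖ maxEntangled R) * (M x ⊗ₖ (1 : Matrix R R ℂ)))
      * (W x).conjTranspose
  map_add' σ τ := by
    have h : ∀ X Y : Matrix ((A × R) × R) ((A × R) × R) ℂ,
        partialTraceFst (X + Y) = partialTraceFst X + partialTraceFst Y := by
      intro X Y
      ext r r'
      simp [partialTraceFst, Finset.sum_add_distrib]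
    simp only [Matrix.add_kronecker, map_add, Matrix.add_mul, h, Matrix.mul_add,
      Finset.sum_add_distrib]
  map_smul' c σ := by
    have h : ∀ X : Matrix ((A × R) × R) ((A × R) × R) ℂ,
        partialTraceFst (c • X) = c • partialTraceFst X := by
      intro X
      ext r r'
      simp [partialTraceFst, Finset.mul_sum]
    simp only [Matrix.smul_kronecker, map_smul, Matrix.smul_mul, h, Matrix.mul_smul,
      Finset.smul_sum, RingHom.id_apply]

/-! ### Superchannels built from pre- and postprocessings -/

/-- The spaces in play: the admissible input-output spaces `R = R₀R₁`, and the ancillas, which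
contain the trivial system and are closed under tensor products. Spaces are labelled, so that a
label may carry further structure, such as a splitting into two parties. -/
structure Systems where
  Adm : Type u
  Anc : Type v
  inp : Adm → Type w
  out : Adm → Type w
  anc : Anc → Type w
  [fintypeInp : ∀ R, Fintype (inp R)]
  [fintypeOut : ∀ R, Fintype (out R)]
  [fintypeAnc : ∀ U, Fintype (anc U)]
  [decEqInp : ∀ R, DecidableEq (inp R)]
  [decEqOut : ∀ R, DecidableEq (out R)]
  [decEqAnc : ∀ U, DecidableEq (anc U)]
  [nonemptyInp : ∀ R, Nonempty (inp R)]
  [nonemptyOut : ∀ R, Nonempty (out R)]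
  [nonemptyAnc : ∀ U, Nonempty (anc U)]
  one : Anc
  [uniqueOne : Unique (anc one)]
  mul : Anc → Anc → Anc
  mulEquiv : ∀ V U, anc (mul V U) ≃ anc V × anc U

attribute [instance] Systems.fintypeInp Systems.fintypeOut Systems.fintypeAnc Systems.decEqInp
  Systems.decEqOut Systems.decEqAnc Systems.nonemptyInp Systems.nonemptyOut Systems.nonemptyAnc
  Systems.uniqueOne

namespace Systems

variable (𝔖 : Systems.{u, v, w})

/-- The identification of `X` with `1 ⊗ X`. -/
def unitor (X : Type w) : X ≃ 𝔖.anc 𝔖.one × X :=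
  (Equiv.uniqueProd X (𝔖.anc 𝔖.one)).symm

/-- The identification of `V ⊗ (U ⊗ X)` with `VU ⊗ X`. -/
def regroup (V U : 𝔖.Anc) (X : Type w) :
    𝔖.anc V × (𝔖.anc U × X) ≃ 𝔖.anc (𝔖.mul V U) × X :=
  (Equiv.prodAssoc _ _ _).symm.trans (Equiv.prodCongr (𝔖.mulEquiv V U).symm (Equiv.refl X))

end Systems

/-- The superchannel `α * β : Φ ↦ β ∘ (id_U ⊗ Φ) ∘ α` with preprocessing `α`, postprocessing `β`
and ancilla `U`. -/
def superchannel {R₀ R₁ S₀ S₁ U : Type*} (α : SMap S₀ (U × R₀)) (β : SMap (U × R₁) S₁) :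
    SMap R₀ R₁ →ₗ[ℂ] SMap S₀ S₁ where
  toFun Φ := β ∘ₗ idTensor U Φ ∘ₗ α
  map_add' Φ Ψ := by
    rw [map_add, LinearMap.add_comp, LinearMap.comp_add]
  map_smul' c Φ := by
    rw [map_smul, LinearMap.smul_comp, LinearMap.comp_smul, RingHom.id_apply]

/-- The set `F(R, S)` of all superchannels with preprocessing in `pre S U R` and postprocessing in
`post U R S`, for some ancilla `U`. -/
def superchannels (𝔖 : Systems.{u, v, w})
    (pre : ∀ (S : 𝔖.Adm) (U : 𝔖.Anc) (R : 𝔖.Adm), Set (SMap (𝔖.inp S) (𝔖.anc U × 𝔖.inp R)))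
    (post : ∀ (U : 𝔖.Anc) (R S : 𝔖.Adm), Set (SMap (𝔖.anc U × 𝔖.out R) (𝔖.out S)))
    (R S : 𝔖.Adm) :
    Set (SMap (𝔖.inp R) (𝔖.out R) →ₗ[ℂ] SMap (𝔖.inp S) (𝔖.out S)) :=
  {Θ | ∃ U, ∃ α ∈ pre S U R, ∃ β ∈ post U R S, Θ = superchannel α β}

/-- The families of allowed preprocessings `C_pre(S₀, U R₀)` and postprocessings
`C_post(U R₁, S₁)`: channels, containing the identities and closed under composition, such that
the sets `F(R, S)` of superchannels that they form are convex. -/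
structure Processings (𝔖 : Systems.{u, v, w}) where
  pre : ∀ (S : 𝔖.Adm) (U : 𝔖.Anc) (R : 𝔖.Adm), Set (SMap (𝔖.inp S) (𝔖.anc U × 𝔖.inp R))
  post : ∀ (U : 𝔖.Anc) (R S : 𝔖.Adm), Set (SMap (𝔖.anc U × 𝔖.out R) (𝔖.out S))
  pre_channel : ∀ S U R, ∀ α ∈ pre S U R, IsChannel α
  post_channel : ∀ U R S, ∀ β ∈ post U R S, IsChannel β
  id_mem_pre : ∀ R, relabel (𝔖.unitor (𝔖.inp R)) ∈ pre R 𝔖.one R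
  id_mem_post : ∀ R, relabel (𝔖.unitor (𝔖.out R)).symm ∈ post 𝔖.one R R
  comp_mem_pre : ∀ R S T U V, ∀ α ∈ pre S U R, ∀ α' ∈ pre T V S,
    relabel (𝔖.regroup V U (𝔖.inp R)) ∘ₗ idTensor (𝔖.anc V) α ∘ₗ α' ∈ pre T (𝔖.mul V U) R
  comp_mem_post : ∀ R S T U V, ∀ β ∈ post U R S, ∀ β' ∈ post V S T,
    β' ∘ₗ idTensor (𝔖.anc V) β ∘ₗ relabel (𝔖.regroup V U (𝔖.out R)).symm ∈
      post (𝔖.mul V U) R T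
  convex : ∀ R S, Convex ℝ (superchannels 𝔖 pre post R S)

/-- A family of allowed measurements: `meas V S T k` is a set of measurements with `k` outcomes
on `V S₁ T₁`. -/
structure Measurements (𝔖 : Systems.{u, v, w}) where
  meas : ∀ (V : 𝔖.Anc) (S T : 𝔖.Adm) (k : ℕ),
    Set (Fin k → Matrix ((𝔖.anc V × 𝔖.out S) × 𝔖.out T) ((𝔖.anc V × 𝔖.out S) × 𝔖.out T) ℂ)
  isMeasurement : ∀ V S T k, ∀ M ∈ meas V S T k, IsMeasurement M

variable {𝔖 : Systems.{u, v, w}}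

/-- Closedness of the measurements under preprocessing by the channels of the family `post`: if
`β ∈ C_post(U R₁, S₁)` and `M` is an allowed measurement on `V S₁ T₁`, then `(id ⊗ β*)(M)` is an
allowed measurement on `V U R₁ T₁`. -/
def Measurements.ClosedUnder (𝓜 : Measurements 𝔖) (𝓒 : Processings 𝔖) : Prop :=
  ∀ (R S T : 𝔖.Adm) (U V : 𝔖.Anc) (k : ℕ), ∀ β ∈ 𝓒.post U R S, ∀ M ∈ 𝓜.meas V S T k,
    (fun i => relabel (Equiv.prodCongr (𝔖.regroup V U (𝔖.out R)) (Equiv.refl (𝔖.out T)))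
      (tensorId (𝔖.out T) (idTensor (𝔖.anc V) (adjointMap β)) (M i))) ∈
        𝓜.meas (𝔖.mul V U) R T k

/-- The conversion distance `δ_F(Φ₁ ‖ Φ₂)`, equal to `⊤` if there is no superchannel in
`F(A, A')`. -/
def conversionDist (𝓒 : Processings 𝔖) (A A' : 𝔖.Adm) (Φ₁ : SMap (𝔖.inp A) (𝔖.out A))
    (Φ₂ : SMap (𝔖.inp A') (𝔖.out A')) : EReal :=
  ⨅ Θ ∈ superchannels 𝔖 𝓒.pre 𝓒.post A A', ((diamondNorm (Θ Φ₁ - Φ₂) : ℝ) : EReal)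

/-- The optimal success probability in the restricted guessing game with the channel `Φ`: the
supremum, over all ancillas `U`, all `α ∈ C_pre(R₀, U A₀)` and all allowed measurements `M` on
`U A₁ R₁`, of the success probability of the measurement `(Φ* ⊗ id)(M)` for the ensemble
`(α ⊗ id)(E)`. It equals `⊥` if there are no such `α` and `M`. -/
def restrictedSuccess (𝓒 : Processings 𝔖) (𝓜 : Measurements 𝔖) (A : 𝔖.Adm)
    (Φ : SMap (𝔖.inp A) (𝔖.out A)) (R : 𝔖.Adm) {k : ℕ}
    (E : Ensemble (𝔖.inp R × 𝔖.out R) k) : EReal :=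
  ⨆ (U : 𝔖.Anc) (α ∈ 𝓒.pre R U A) (M ∈ 𝓜.meas U A R k),
    ((successProb E.prob (fun i => tensorId (𝔖.out R) α (E.state i))
      (fun i => tensorId (𝔖.out R) (idTensor (𝔖.anc U) (adjointMap Φ)) (M i)) : ℝ) : EReal)

end ChannelComparison

end

open ChannelComparison

/-! The diamond distance of two channels is expressed through the completely positive order. If `‖Φ
- Ψ‖_⋄ < 2c`, there is a channel `γ` with `cγ - (Φ - Ψ)` completely positive
(`exists_channel_isCompletelyPositive_sub`, semidefinite duality); conversely such a `γ` gives `‖Φ -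
Ψ‖_⋄ ≤ 2c` (`diamondNorm_le_of_le`). So `δ_F(Φ₁ ‖ Φ₂) ≤ ε` says that, up to arbitrarily small
errors, `Φ₂` is dominated by `Θ(Φ₁) + (ε/2)γ` for some `Θ` in `F` and some channel `γ`.

Given such a domination, a strategy `(α, M)` for the game with `Φ₂` succeeds with at most its
probability for `Θ(Φ₁)` plus a multiple of its probability for `γ`. The first is a probability
attainable with `Φ₁`, since pre- and postprocessings compose; the second is at most `P_succ(E)`.

For the converse, the Choi matrices of the maps `Θ(Φ₁) + (ε/2)γ` form a convex set. By Hahn-Banach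
an element of it dominates the Choi matrix of `Φ₂` up to a small multiple of `1`, once no positive
functional separates them. Up to a positive factor, a nonzero positive functional on Choi matrices
is the overlap of `(Ψ ⊗ id)(ρ)` with the maximally entangled state, for some state `ρ`.
Teleportation turns overlaps into guessing games: for the ensemble of Pauli rotations of `ρ`, a
measurement `M` after `Ψ` succeeds with the overlap of `β^M ∘ Ψ` (`successProb_pauliEnsemble`), and
the Bell measurement with that of `Ψ` itself. Since `β^M` is an allowed postprocessing, and `β^N` is
a channel for every measurement `N` on the ensemble, `(*)` for this ensemble is the required
inequality between functionals. -/

/-! ### Positive semidefinite matrices and the trace pairing -/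

theorem Matrix.PosSemidef.exists_eq_conjTranspose_mul_self {n : Type*} [Fintype n] [DecidableEq n]
    {X : Matrix n n ℂ} (hX : X.PosSemidef) : ∃ B : Matrix n n ℂ, X = B.conjTranspose * B := by
  open scoped MatrixOrder Matrix.Norms.L2Operator in
  exact CStarAlgebra.nonneg_iff_eq_star_mul_self.mp hX.nonneg

theorem Matrix.PosSemidef.trace_mul_nonneg {n : Type*} [Fintype n] {X Y : Matrix n n ℂ}
    (hX : X.PosSemidef) (hY : Y.PosSemidef) : 0 ≤ (X * Y).trace := by
  classical
  obtain ⟨B, rfl⟩ := hY.exists_eq_conjTranspose_mul_self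
  rw [← Matrix.mul_assoc, Matrix.trace_mul_comm, ← Matrix.mul_assoc]
  exact (hX.mul_mul_conjTranspose_same B).trace_nonneg

theorem Matrix.trace_vecMulVec_star_mul {n : Type*} [Fintype n] (X : Matrix n n ℂ) (x : n → ℂ) :
    (Matrix.vecMulVec x (star x) * X).trace = star x ⬝ᵥ X.mulVec x := by
  rw [Matrix.vecMulVec_mul, Matrix.trace_vecMulVec, dotProduct_comm, Matrix.dotProduct_mulVec]

/-- Self-duality of the cone of positive semidefinite matrices. -/
theorem Matrix.posSemidef_of_trace_mul_nonneg {n : Type*} [Fintype n] {X : Matrix n n ℂ}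
    (h : ∀ Y : Matrix n n ℂ, Y.PosSemidef → 0 ≤ (Y * X).trace) : X.PosSemidef := by
  classical
  have h2 : ∀ x : n → ℂ, 0 ≤ star x ⬝ᵥ X.mulVec x := fun x => by
    rw [← Matrix.trace_vecMulVec_star_mul]
    exact h _ (Matrix.posSemidef_vecMulVec_self_star x)
  refine Matrix.PosSemidef.of_dotProduct_mulVec_nonneg ?_ h2
  -- Over `ℂ`, a matrix with real quadratic form is Hermitian.
  rw [← Matrix.isSymmetric_toEuclideanLin_iff, LinearMap.isSymmetric_iff_inner_map_self_real]
  intro v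
  have h3 := h2 v
  have h4 : inner ℂ v ((Matrix.toEuclideanLin X) v) = star v.ofLp ⬝ᵥ X.mulVec v.ofLp := by
    rw [EuclideanSpace.inner_eq_star_dotProduct, dotProduct_comm]; rfl
  rw [← inner_conj_symm, h4, Complex.conj_conj]
  exact (Complex.conj_eq_iff_im.mpr (Complex.nonneg_iff.mp h3).2.symm).symm

theorem Matrix.posSemidef_of_re_trace_mul_nonneg {n : Type*} [Fintype n] {X : Matrix n n ℂ}
    (hX : X.IsHermitian)
    (h : ∀ Y : Matrix n n ℂ, Y.PosSemidef → 0 ≤ (Y * X).trace.re) : X.PosSemidef := by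
  refine Matrix.posSemidef_of_trace_mul_nonneg fun Y hY => ?_
  refine Complex.nonneg_iff.mpr ⟨h Y hY, ?_⟩
  have : star (Y * X).trace = (Y * X).trace := by
    rw [← Matrix.trace_conjTranspose, Matrix.conjTranspose_mul, hX.eq, hY.1.eq,
      Matrix.trace_mul_comm]
  exact (Complex.conj_eq_iff_im.mp this).symm

namespace ChannelComparison

/-! ### The trace norm of Hermitian matrices of trace zero -/

section TraceNorm

variable {n : Type*} [Fintype n] [DecidableEq n] {H : Matrix n n ℂ}

/-- The eigenvalues of `Hᴴ * H` and of `H` are not indexed compatibly, so they are compared as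
multisets of roots of a characteristic polynomial. -/
theorem traceNorm_eq_sum_abs_eigenvalues (hH : H.IsHermitian) :
    traceNorm H = ∑ i, |hH.eigenvalues i| := by
  set U := hH.eigenvectorUnitary
  set D : n → ℂ := fun i => (hH.eigenvalues i : ℂ)
  have h1 : H.conjTranspose * H =
      (U : Matrix n n ℂ) * Matrix.diagonal (fun i => D i * D i) * star (U : Matrix n n ℂ) := by
    have hs := hH.spectral_theorem
    rw [Unitary.conjStarAlgAut_apply] at hs
    rw [hH.eq]
    conv_lhs => rw [hs]
    have hU : star (U : Matrix n n ℂ) * U = 1 := Unitary.coe_star_mul_self U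
    calc _ = (U : Matrix n n ℂ) * Matrix.diagonal D * (star (U : Matrix n n ℂ) * U) *
          Matrix.diagonal D * star (U : Matrix n n ℂ) := by
            simp only [Matrix.mul_assoc]; rfl
      _ = _ := by
        rw [hU, Matrix.mul_one, Matrix.mul_assoc (U : Matrix n n ℂ), Matrix.diagonal_mul_diagonal]
  have h2 : (H.conjTranspose * H).charpoly.roots =
      Multiset.map (fun i => D i * D i) Finset.univ.val := by
    rw [h1, Matrix.charpoly_mul_comm, ← Matrix.mul_assoc, Unitary.coe_star_mul_self, Matrix.one_mul,
      Matrix.charpoly_diagonal, ← Polynomial.roots_multiset_prod_X_sub_C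
        (Multiset.map (fun i => D i * D i) Finset.univ.val), Multiset.map_map]
    rfl
  rw [(Matrix.isHermitian_conjTranspose_mul_self H).roots_charpoly_eq_eigenvalues] at h2
  have h3 := congrArg (fun s => (s.map fun z : ℂ => √z.re).sum) h2
  simp only [Multiset.map_map] at h3
  calc traceNorm H = _ := rfl
    _ = _ := h3
    _ = _ := by
      refine Finset.sum_congr rfl fun i _ => ?_
      simp [D, Real.sqrt_mul_self_eq_abs]

/-- The diagonal of a matrix in an eigenbasis of `H`. -/
theorem sum_eigenbasis_diag (hH : H.IsHermitian) (P : Matrix n n ℂ) :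
    ∑ i, ((star (hH.eigenvectorUnitary : Matrix n n ℂ) * P *
      (hH.eigenvectorUnitary : Matrix n n ℂ)) i i) = P.trace := by
  change Matrix.trace _ = _
  rw [Matrix.trace_mul_comm, ← Matrix.mul_assoc,
    Unitary.mul_star_self_of_mem hH.eigenvectorUnitary.2, Matrix.one_mul]

theorem eigenbasis_diag_self (hH : H.IsHermitian) (i : n) :
    (star (hH.eigenvectorUnitary : Matrix n n ℂ) * H *
      (hH.eigenvectorUnitary : Matrix n n ℂ)) i i = hH.eigenvalues i := by
  have hs := hH.conjStarAlgAut_star_eigenvectorUnitary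
  rw [Unitary.conjStarAlgAut_apply] at hs
  have := congrFun (congrFun hs i) i
  simpa using this

theorem trace_mul_eq_sum_eigenvalues_mul (hH : H.IsHermitian) (P : Matrix n n ℂ) :
    (H * P).trace = ∑ i, (hH.eigenvalues i : ℂ) *
      (star (hH.eigenvectorUnitary : Matrix n n ℂ) * P *
        (hH.eigenvectorUnitary : Matrix n n ℂ)) i i := by
  have hs := hH.spectral_theorem
  rw [Unitary.conjStarAlgAut_apply] at hs
  conv_lhs => rw [hs]
  rw [Matrix.mul_assoc, Matrix.mul_assoc, Matrix.trace_mul_comm, Matrix.mul_assoc]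
  simp only [Matrix.trace, Matrix.diag, Matrix.diagonal_mul, Matrix.mul_assoc]
  rfl

theorem two_mul_sum_posPart_eigenvalues (hH : H.IsHermitian) (h0 : H.trace = 0) :
    traceNorm H = 2 * ∑ i, max (hH.eigenvalues i) 0 := by
  have h1 : ∑ i, hH.eigenvalues i = 0 := by
    have := hH.trace_eq_sum_eigenvalues
    rw [h0] at this
    simpa using congrArg Complex.re this.symm
  rw [traceNorm_eq_sum_abs_eigenvalues hH, Finset.mul_sum]
  have : ∀ i, |hH.eigenvalues i| = 2 * max (hH.eigenvalues i) 0 - hH.eigenvalues i := by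
    intro i
    rcases le_total 0 (hH.eigenvalues i) with h | h
    · rw [abs_of_nonneg h, max_eq_left h]; ring
    · rw [abs_of_nonpos h, max_eq_right h]; ring
  rw [Finset.sum_congr rfl fun i _ => this i, Finset.sum_sub_distrib, h1, sub_zero]

/-- In an eigenbasis of `H`, the diagonal entries of `K` dominate both `0` and the eigenvalues of
`H`, hence their positive parts. -/
theorem traceNorm_le_of_le {K : Matrix n n ℂ} (h0 : H.trace = 0) (hK : K.PosSemidef)
    (hHK : (K - H).PosSemidef) : traceNorm H ≤ 2 * K.trace.re := by
  have hH : H.IsHermitian := by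
    have := hK.1.sub hHK.1
    rwa [sub_sub_cancel] at this
  rw [two_mul_sum_posPart_eigenvalues hH h0, ← sum_eigenbasis_diag hH K, Complex.re_sum]
  gcongr with i
  have h1 := (hK.conjTranspose_mul_mul_same (hH.eigenvectorUnitary : Matrix n n ℂ)).diag_nonneg
    (i := i)
  have h2 := (hHK.conjTranspose_mul_mul_same (hH.eigenvectorUnitary : Matrix n n ℂ)).diag_nonneg
    (i := i)
  rw [Matrix.mul_sub, Matrix.sub_mul, Matrix.sub_apply, ← Matrix.star_eq_conjTranspose,
    eigenbasis_diag_self hH] at h2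
  rw [← Matrix.star_eq_conjTranspose] at h1
  have h1' := (Complex.nonneg_iff.mp h1).1
  have h2' := (Complex.nonneg_iff.mp h2).1
  rw [Complex.sub_re, Complex.ofReal_re] at h2'
  exact max_le (by linarith) h1'

/-- In an eigenbasis of `H`, the diagonal entries of `P` lie in `[0, 1]`, so they pick up at most
the positive parts of the eigenvalues. -/
theorem two_mul_re_trace_mul_le_traceNorm {P : Matrix n n ℂ} (hH : H.IsHermitian)
    (h0 : H.trace = 0) (hP : P.PosSemidef) (hP1 : (1 - P).PosSemidef) :
    2 * (H * P).trace.re ≤ traceNorm H := by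
  rw [two_mul_sum_posPart_eigenvalues hH h0, trace_mul_eq_sum_eigenvalues_mul hH, Complex.re_sum]
  gcongr with i
  have h1 := (hP.conjTranspose_mul_mul_same (hH.eigenvectorUnitary : Matrix n n ℂ)).diag_nonneg
    (i := i)
  have h2 := (hP1.conjTranspose_mul_mul_same (hH.eigenvectorUnitary : Matrix n n ℂ)).diag_nonneg
    (i := i)
  rw [Matrix.mul_sub, Matrix.sub_mul, Matrix.sub_apply, ← Matrix.star_eq_conjTranspose,
    Matrix.mul_one, Unitary.coe_star_mul_self, Matrix.one_apply_eq] at h2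
  rw [← Matrix.star_eq_conjTranspose] at h1
  have h1' := (Complex.nonneg_iff.mp h1).1
  have h2' := (Complex.nonneg_iff.mp h2).1
  rw [Complex.sub_re, Complex.one_re] at h2'
  rw [Complex.re_ofReal_mul]
  rcases le_total 0 (hH.eigenvalues i) with h | h
  · rw [max_eq_left h]; nlinarith
  · rw [max_eq_right h]; nlinarith

end TraceNorm

/-! ### Hahn-Banach separation in the positive semidefinite order -/

/-- Every real linear functional is given, on Hermitian matrices, by the trace against a Hermitian
matrix. -/
theorem exists_isHermitian_forall_eq_re_trace {n : Type*} [Fintype n] [DecidableEq n]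
    (f : Matrix n n ℂ →ₗ[ℝ] ℝ) : ∃ X : Matrix n n ℂ, X.IsHermitian ∧
      ∀ Z : Matrix n n ℂ, Z.IsHermitian → f Z = (X * Z).trace.re := by
  set X : Matrix n n ℂ := Matrix.of fun j i =>
    (f (Matrix.single i j 1) : ℂ) - f (Matrix.single i j Complex.I) * Complex.I with hX
  have h1 : ∀ Z : Matrix n n ℂ, f Z = (X * Z).trace.re := by
    intro Z
    have h : ∀ i j, Matrix.single i j (Z i j) =
        (Z i j).re • Matrix.single i j (1 : ℂ) + (Z i j).im • Matrix.single i j Complex.I := by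
      intro i j
      rw [Matrix.smul_single, Matrix.smul_single, ← Matrix.single_add]
      congr 1
      apply Complex.ext <;> simp
    conv_lhs => rw [Matrix.matrix_eq_sum_single Z]
    simp only [h, map_sum, map_add, map_smul, smul_eq_mul]
    rw [Matrix.trace, Complex.re_sum, Finset.sum_comm]
    refine Finset.sum_congr rfl fun j _ => ?_
    rw [Matrix.diag, Matrix.mul_apply, Complex.re_sum]
    refine Finset.sum_congr rfl fun i _ => ?_
    simp [hX]
    ring
  -- Pass to the Hermitian part; the trace of the skew-Hermitian part against a Hermitian matrix is
  -- purely imaginary.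
  refine ⟨(2⁻¹ : ℂ) • (X + X.conjTranspose), ?_, fun Z hZ => ?_⟩
  · rw [Matrix.IsHermitian, Matrix.conjTranspose_smul, Matrix.conjTranspose_add,
      Matrix.conjTranspose_conjTranspose, add_comm]
    simp
  · have h2 : (X.conjTranspose * Z).trace.re = (X * Z).trace.re := by
      rw [← Complex.conj_re]
      change (star (X.conjTranspose * Z).trace).re = _
      rw [← Matrix.trace_conjTranspose, Matrix.conjTranspose_mul, hZ.eq,
        Matrix.conjTranspose_conjTranspose, Matrix.trace_mul_comm]
    rw [h1, Matrix.smul_mul, Matrix.add_mul, Matrix.trace_smul, Matrix.trace_add, smul_eq_mul,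
      Complex.mul_re, Complex.add_re, h2]
    norm_num
    ring

/-- Positive semidefinite matrices as the dual of a cone: if a Hermitian matrix `H` is dominated by
the convex set `C` in every positive semidefinite direction, then up to an arbitrarily small error
it is dominated by an element of `C`. -/
theorem exists_mem_convex_posSemidef_add_smul_one_sub {n : Type*} [Fintype n] [DecidableEq n]
    {C : Set (Matrix n n ℂ)} (hC : Convex ℝ C) (hne : C.Nonempty) (hherm : ∀ k ∈ C, k.IsHermitian)
    {H : Matrix n n ℂ} (hH : H.IsHermitian)
    (hdual : ∀ X : Matrix n n ℂ, X.PosSemidef → ∀ s : ℝ,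
      (∀ k ∈ C, (X * k).trace.re ≤ s) → (X * H).trace.re ≤ s)
    {η : ℝ} (hη : 0 < η) : ∃ k ∈ C, (k + (η : ℂ) • (1 : Matrix n n ℂ) - H).PosSemidef := by
  open scoped MatrixOrder Matrix.Norms.L2Operator in
  -- `K` is closed under subtracting positive semidefinite matrices, so a functional bounded above
  -- on it is nonnegative on the cone. As `C` need not be closed, `H` is only shown to lie in the
  -- closure of `K`, whence the error `η`.
  set K : Set (Matrix n n ℂ) := {Z | ∃ k ∈ C, (k - Z).PosSemidef}
  have hKconv : Convex ℝ K := by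
    rintro Z ⟨k, hk, hkZ⟩ Z' ⟨k', hk', hkZ'⟩ a b ha hb hab
    refine ⟨a • k + b • k', hC hk hk' ha hb hab, ?_⟩
    have : a • k + b • k' - (a • Z + b • Z') = a • (k - Z) + b • (k' - Z') := by
      rw [smul_sub, smul_sub]; abel
    rw [this]
    exact (hkZ.smul ha).add (hkZ'.smul hb)
  have hmem : H ∈ closure K := by
    by_contra hcon
    obtain ⟨f, u, hfu, huH⟩ := geometric_hahn_banach_closed_point hKconv.closure isClosed_closure
      hcon
    obtain ⟨X, hX, hfX⟩ := exists_isHermitian_forall_eq_re_trace f.toLinearMap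
    have hfX' : ∀ Z : Matrix n n ℂ, Z.IsHermitian → f Z = (X * Z).trace.re := hfX
    obtain ⟨k₀, hk₀⟩ := hne
    have hXpos : X.PosSemidef := by
      refine Matrix.posSemidef_of_re_trace_mul_nonneg hX fun Y hY => ?_
      rw [Matrix.trace_mul_comm, ← hfX' Y hY.1]
      by_contra hneg
      push Not at hneg
      -- Chosen so that `f (k₀ - t • Y) = u`, against the strict bound on `K`.
      set t : ℝ := (f k₀ - u) / f Y
      have hk0 : f k₀ < u := hfu _ (subset_closure ⟨k₀, hk₀, by simpa using Matrix.PosSemidef.zero⟩)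
      have ht : 0 ≤ t := div_nonneg_of_nonpos (by linarith) hneg.le
      have := hfu (k₀ - t • Y) (subset_closure ⟨k₀, hk₀, by simpa using hY.smul ht⟩)
      rw [map_sub, map_smul, smul_eq_mul, div_mul_cancel₀ _ hneg.ne] at this
      linarith
    have := hdual X hXpos u fun k hk => by
      rw [← hfX' k (hherm k hk)]
      exact (hfu _ (subset_closure ⟨k, hk, by simpa using Matrix.PosSemidef.zero⟩)).le
    rw [← hfX' H hH] at this
    linarith
  obtain ⟨Z, ⟨k, hk, hkZ⟩, hZ⟩ := Metric.mem_closure_iff.mp hmem η hη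
  refine ⟨k, hk, ?_⟩
  have hZherm : Z.IsHermitian := by
    have := (hherm k hk).sub hkZ.1
    rwa [sub_sub_cancel] at this
  have h1 : H - Z ≤ algebraMap ℝ (Matrix n n ℂ) ‖H - Z‖ :=
    IsSelfAdjoint.le_algebraMap_norm_self (hH.sub hZherm)
  rw [Matrix.le_iff] at h1
  rw [dist_eq_norm] at hZ
  have h2 : k + (η : ℂ) • (1 : Matrix n n ℂ) - H = (k - Z) +
      (algebraMap ℝ (Matrix n n ℂ) ‖H - Z‖ - (H - Z)) + (η - ‖H - Z‖) • (1 : Matrix n n ℂ) := by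
    rw [Algebra.algebraMap_eq_smul_one, sub_smul, ← Complex.coe_smul η]
    abel
  rw [h2]
  exact (hkZ.add h1).add (Matrix.PosSemidef.one.smul (sub_pos.mpr hZ).le)

/-! ### Maps of matrices: blocks, adjoints and channels -/

section Maps

variable {A B C R U : Type*}

/-- The block of a bipartite matrix at the pair `(r, r')` of the second factor. -/
def blockSnd (X : Matrix (A × R) (B × R) ℂ) (r r' : R) : Matrix A B ℂ :=
  Matrix.of fun a b => X (a, r) (b, r')

/-- The block of a bipartite matrix at the pair `(u, u')` of the first factor. -/
def blockFst (X : Matrix (U × A) (U × B) ℂ) (u u' : U) : Matrix A B ℂ :=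
  Matrix.of fun a b => X (u, a) (u', b)

theorem ext_blockSnd {X Y : Matrix (A × R) (B × R) ℂ}
    (h : ∀ r r', blockSnd X r r' = blockSnd Y r r') : X = Y :=
  Matrix.ext fun p q => congrFun (congrFun (h p.2 q.2) p.1) q.1

theorem blockSnd_tensorId (Φ : SMap A B) (X : Matrix (A × R) (A × R) ℂ) (r r' : R) :
    blockSnd (tensorId R Φ X) r r' = Φ (blockSnd X r r') := rfl

theorem blockFst_idTensor (Φ : SMap A B) (X : Matrix (U × A) (U × A) ℂ) (u u' : U) :
    blockFst (idTensor U Φ X) u u' = Φ (blockFst X u u') := rfl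

theorem trace_eq_sum_blockSnd [Fintype A] [Fintype R] (X : Matrix (A × R) (A × R) ℂ) :
    X.trace = ∑ r, (blockSnd X r r).trace := by
  simp only [Matrix.trace, Matrix.diag, blockSnd, Matrix.of_apply, Fintype.sum_prod_type_right]

theorem trace_eq_sum_blockFst [Fintype A] [Fintype U] (X : Matrix (U × A) (U × A) ℂ) :
    X.trace = ∑ u, (blockFst X u u).trace := by
  simp only [Matrix.trace, Matrix.diag, blockFst, Matrix.of_apply, Fintype.sum_prod_type]

theorem trace_mul_eq_sum_blockSnd [Fintype A] [Fintype R] (X Y : Matrix (A × R) (A × R) ℂ) :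
    (X * Y).trace = ∑ r, ∑ r', (blockSnd X r r' * blockSnd Y r' r).trace := by
  simp only [Matrix.trace, Matrix.diag, blockSnd, Matrix.of_apply, Fintype.sum_prod_type_right,
    Matrix.mul_apply]
  exact Finset.sum_congr rfl fun r _ => Finset.sum_comm

theorem trace_mul_eq_sum_blockFst [Fintype A] [Fintype U] (X Y : Matrix (U × A) (U × A) ℂ) :
    (X * Y).trace = ∑ u, ∑ u', (blockFst X u u' * blockFst Y u' u).trace := by
  simp only [Matrix.trace, Matrix.diag, blockFst, Matrix.of_apply, Fintype.sum_prod_type,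
    Matrix.mul_apply]
  exact Finset.sum_congr rfl fun r _ => Finset.sum_comm

/-- Two maps that are adjoint with respect to the trace pairing. -/
def IsTraceAdjoint [Fintype A] [Fintype B] (Φ : SMap A B) (Ψ : SMap B A) : Prop :=
  ∀ X Y, (Φ X * Y).trace = (X * Ψ Y).trace

theorem isTraceAdjoint_adjointMap [Fintype A] [Fintype B] [DecidableEq A] (Φ : SMap A B) :
    IsTraceAdjoint Φ (adjointMap Φ) :=
  fun X Y => (trace_mul_adjointMap Φ X Y).symm

theorem IsTraceAdjoint.tensorId_right [Fintype A] [Fintype B] [Fintype R] {Φ : SMap A B} {Ψ : SMap B A}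
    (h : IsTraceAdjoint Φ Ψ) : IsTraceAdjoint (tensorId R Φ) (tensorId R Ψ) := fun X Y => by
  simp only [trace_mul_eq_sum_blockSnd, blockSnd_tensorId, h _ _]

theorem IsTraceAdjoint.idTensor_left [Fintype A] [Fintype B] [Fintype U] {Φ : SMap A B} {Ψ : SMap B A}
    (h : IsTraceAdjoint Φ Ψ) : IsTraceAdjoint (idTensor U Φ) (idTensor U Ψ) := fun X Y => by
  simp only [trace_mul_eq_sum_blockFst, blockFst_idTensor, h _ _]

theorem tensorId_comp (Φ : SMap A B) (Ψ : SMap C A) :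
    tensorId R (Φ ∘ₗ Ψ) = tensorId R Φ ∘ₗ tensorId R Ψ := rfl

theorem tensorId_sub (Φ Ψ : SMap A B) : tensorId R (Φ - Ψ) = tensorId R Φ - tensorId R Ψ := rfl

theorem tensorId_add (Φ Ψ : SMap A B) : tensorId R (Φ + Ψ) = tensorId R Φ + tensorId R Ψ := rfl

theorem tensorId_smul (c : ℂ) (Φ : SMap A B) : tensorId R (c • Φ) = c • tensorId R Φ := rfl

theorem relabel_apply (e : A ≃ B) (X : Matrix A A ℂ) :
    relabel e X = X.submatrix e.symm e.symm := rfl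

theorem trace_relabel_mul_relabel [Fintype A] [Fintype B] (e : A ≃ B) (X Y : Matrix A A ℂ) :
    (relabel e X * relabel e Y).trace = (X * Y).trace := by
  rw [relabel_apply, relabel_apply, Matrix.submatrix_mul_equiv]
  exact Equiv.sum_comp e.symm fun i => (X * Y) i i

/-! ### Complete positivity and the Choi matrix -/

theorem IsCompletelyPositive.tensorId_posSemidef [Finite R] {Φ : SMap A B}
    (h : IsCompletelyPositive Φ) {X : Matrix (A × R) (A × R) ℂ} (hX : X.PosSemidef) :
    (tensorId R Φ X).PosSemidef := by
  obtain ⟨n, ⟨e⟩⟩ := Finite.exists_equiv_fin R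
  have h1 := h n _ (hX.submatrix (Prod.map id e.symm))
  have h2 := h1.submatrix (Prod.map id e)
  convert h2 using 1
  ext p q
  simp [tensorId]

theorem IsCompletelyPositive.comp {Φ : SMap A B} {Ψ : SMap C A} (hΦ : IsCompletelyPositive Φ)
    (hΨ : IsCompletelyPositive Ψ) : IsCompletelyPositive (Φ ∘ₗ Ψ) :=
  fun n X hX => hΦ n _ (hΨ n X hX)

theorem IsCompletelyPositive.idTensor_left [Finite U] {Φ : SMap A B}
    (h : IsCompletelyPositive Φ) : IsCompletelyPositive (idTensor U Φ) := fun n _ hX =>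
  (h.tensorId_posSemidef (R := U × Fin n)
    (hX.submatrix fun p : A × (U × Fin n) => ((p.2.1, p.1), p.2.2))).submatrix
      fun p : (U × B) × Fin n => (p.1.2, (p.1.1, p.2))

theorem IsCompletelyPositive.add {Φ Ψ : SMap A B} (hΦ : IsCompletelyPositive Φ)
    (hΨ : IsCompletelyPositive Ψ) : IsCompletelyPositive (Φ + Ψ) :=
  fun n X hX => (hΦ n X hX).add (hΨ n X hX)

theorem IsCompletelyPositive.smul {Φ : SMap A B} (hΦ : IsCompletelyPositive Φ) {c : ℝ}
    (hc : 0 ≤ c) : IsCompletelyPositive ((c : ℂ) • Φ) :=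
  fun n X hX => by
    have := (hΦ n X hX).smul (α := ℂ) (Complex.zero_le_real.mpr hc)
    exact this

theorem IsChannel.comp [Fintype A] [Fintype B] [Fintype C] {Φ : SMap A B} {Ψ : SMap C A}
    (hΦ : IsChannel Φ) (hΨ : IsChannel Ψ) : IsChannel (Φ ∘ₗ Ψ) :=
  ⟨hΦ.1.comp hΨ.1, fun X => (hΦ.2 _).trans (hΨ.2 X)⟩

theorem IsChannel.idTensor_left [Fintype A] [Fintype B] [Fintype U] {Φ : SMap A B}
    (hΦ : IsChannel Φ) : IsChannel (idTensor U Φ) :=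
  ⟨hΦ.1.idTensor_left, fun X => by
    simp only [trace_eq_sum_blockFst, blockFst_idTensor, hΦ.2]⟩

theorem trace_tensorId [Fintype A] [Fintype B] [Fintype R] {Φ : SMap A B} {c : ℂ}
    (h : ∀ X, (Φ X).trace = c * X.trace) (X : Matrix (A × R) (A × R) ℂ) :
    (tensorId R Φ X).trace = c * X.trace := by
  simp only [trace_eq_sum_blockSnd, blockSnd_tensorId, h, Finset.mul_sum]

theorem IsChannel.isState_tensorId [Fintype A] [Fintype B] [Fintype R] {Φ : SMap A B}
    (hΦ : IsChannel Φ) {ρ : Matrix (A × R) (A × R) ℂ} (hρ : IsState ρ) :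
    IsState (tensorId R Φ ρ) :=
  ⟨hΦ.1.tensorId_posSemidef hρ.1, by
    rw [trace_tensorId (c := 1) (by simpa using hΦ.2), hρ.2, one_mul]⟩

theorem IsChannel.superchannel_apply {R₀ R₁ S₀ S₁ : Type*} [Fintype R₀] [Fintype R₁] [Fintype S₀]
    [Fintype S₁] [Fintype U] {α : SMap S₀ (U × R₀)} {β : SMap (U × R₁) S₁} {Φ : SMap R₀ R₁}
    (hα : IsChannel α) (hβ : IsChannel β) (hΦ : IsChannel Φ) :
    IsChannel (superchannel α β Φ) :=
  hβ.comp (hΦ.idTensor_left.comp hα)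

/-- The Choi matrix. -/
def choi [DecidableEq A] : SMap A B →ₗ[ℂ] Matrix (B × A) (B × A) ℂ where
  toFun Φ := Matrix.of fun p q => Φ (Matrix.single p.2 q.2 1) p.1 q.1
  map_add' _ _ := rfl
  map_smul' _ _ := rfl

theorem apply_eq_sum_choi [Fintype A] [DecidableEq A] (Φ : SMap A B) (X : Matrix A A ℂ) (b b' : B) :
    Φ X b b' = ∑ a, ∑ a', X a a' * choi Φ (b, a) (b', a') := by
  conv_lhs => rw [Matrix.matrix_eq_sum_single X]
  have h : ∀ i j, Matrix.single i j (X i j) = X i j • Matrix.single i j (1 : ℂ) := by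
    intro i j
    simp
  simp only [h, map_sum, map_smul, Matrix.sum_apply, Matrix.smul_apply, smul_eq_mul]
  rfl

theorem tensorId_apply_eq_sum_choi [Fintype A] [DecidableEq A] (Φ : SMap A B)
    (X : Matrix (A × R) (A × R) ℂ) (p q : B × R) :
    tensorId R Φ X p q = ∑ a, ∑ a', X (a, p.2) (a', q.2) * choi Φ (p.1, a) (q.1, a') :=
  apply_eq_sum_choi Φ (blockSnd X p.2 q.2) p.1 q.1

/-- The map with a given Choi matrix. -/
def ofChoi [Fintype A] (J : Matrix (B × A) (B × A) ℂ) : SMap A B where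
  toFun X := Matrix.of fun b b' => ∑ a, ∑ a', X a a' * J (b, a) (b', a')
  map_add' X Y := by
    ext b b'
    simp [add_mul, Finset.sum_add_distrib]
  map_smul' c X := by
    ext b b'
    simp [mul_assoc, Finset.mul_sum]

theorem choi_ofChoi [Fintype A] [DecidableEq A] (J : Matrix (B × A) (B × A) ℂ) :
    choi (ofChoi J) = J := by
  ext ⟨b, a⟩ ⟨b', a'⟩
  change ∑ i, ∑ j, Matrix.single a a' (1 : ℂ) i j * J (b, i) (b', j) = _
  simp [Matrix.single, ite_and]

theorem isCompletelyPositive_of_choi [Fintype A] [DecidableEq A] [Finite B] {Φ : SMap A B}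
    (h : (choi Φ).PosSemidef) : IsCompletelyPositive Φ := by
  classical
  have := Fintype.ofFinite B
  intro n X hX
  -- `V` identifies the two copies of `A`, so that `(Φ ⊗ id)(X) = Vᴴ (X ⊗ J) V` with `J` the Choi
  -- matrix.
  set V : Matrix ((A × Fin n) × (B × A)) (B × Fin n) ℂ := Matrix.of fun p q =>
    if p.1.1 = p.2.2 ∧ p.1.2 = q.2 ∧ p.2.1 = q.1 then 1 else 0 with hV
  refine (congrArg Matrix.PosSemidef ?_).mpr ((hX.kronecker h).conjTranspose_mul_mul_same V)
  ext ⟨b, r⟩ ⟨b', r'⟩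
  rw [tensorId_apply_eq_sum_choi]
  simp only [Matrix.mul_apply, hV, Matrix.conjTranspose_apply, Matrix.of_apply,
    Fintype.sum_prod_type, Matrix.kroneckerMap_apply, apply_ite star, star_one, star_zero,
    ite_and, ite_mul, mul_ite, one_mul, mul_one, zero_mul, mul_zero, Finset.sum_ite_eq,
    Finset.mem_univ, if_true]
  rw [Finset.sum_comm]
  simp

/-- The unnormalized maximally entangled operator. -/
def entangled (A : Type*) [DecidableEq A] : Matrix (A × A) (A × A) ℂ :=
  Matrix.vecMulVec (fun p => if p.1 = p.2 then 1 else 0) (fun p => if p.1 = p.2 then 1 else 0)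

theorem entangled_posSemidef [DecidableEq A] [Finite A] : (entangled A).PosSemidef := by
  have := Fintype.ofFinite A
  have h : star (fun p : A × A => if p.1 = p.2 then (1 : ℂ) else 0) =
      fun p => if p.1 = p.2 then 1 else 0 := by
    funext p
    simp [apply_ite]
  have := Matrix.posSemidef_vecMulVec_self_star (fun p : A × A => if p.1 = p.2 then (1 : ℂ) else 0)
  rwa [h] at this

theorem tensorId_entangled [DecidableEq A] (Φ : SMap A B) :
    tensorId A Φ (entangled A) = choi Φ := by
  ext ⟨b, a⟩ ⟨b', a'⟩
  refine congrFun (congrFun (congrArg Φ (Matrix.ext fun i j => ?_)) b) b'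
  simp only [entangled, Matrix.vecMulVec_apply, Matrix.single, Matrix.of_apply, mul_ite, mul_one,
    mul_zero, ← ite_and]
  exact if_congr ⟨fun h => ⟨h.2.symm, h.1.symm⟩, fun h => ⟨h.2.symm, h.1.symm⟩⟩ rfl rfl

theorem IsCompletelyPositive.choi_posSemidef [DecidableEq A] [Finite A] {Φ : SMap A B}
    (h : IsCompletelyPositive Φ) : (choi Φ).PosSemidef := by
  rw [← tensorId_entangled]
  exact h.tensorId_posSemidef entangled_posSemidef

theorem blockSnd_conj_one_kronecker [Fintype A] [DecidableEq A] [Fintype R] (S T : Matrix R R ℂ)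
    (X : Matrix (A × R) (A × R) ℂ) (r r' : R) :
    blockSnd (((1 : Matrix A A ℂ) ⊗ₖ S) * X * ((1 : Matrix A A ℂ) ⊗ₖ T)) r r' =
      ∑ t, ∑ s, (S r s * T t r') • blockSnd X s t := by
  ext a a'
  simp only [blockSnd, Matrix.mul_apply, Matrix.of_apply, Fintype.sum_prod_type_right,
    Matrix.kroneckerMap_apply, Matrix.one_apply, ite_mul, mul_ite, one_mul, zero_mul, mul_zero,
    Matrix.sum_apply, Matrix.smul_apply, smul_eq_mul, Finset.sum_mul, Finset.sum_ite_eq,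
    Finset.sum_ite_eq', Finset.mem_univ, if_true]
  exact Finset.sum_congr rfl fun t _ => Finset.sum_congr rfl fun s _ => by ring

/-- `Φ ⊗ id` commutes with operators acting on the ancilla. -/
theorem tensorId_conj [Fintype A] [DecidableEq A] [Fintype B] [DecidableEq B] [Fintype R]
    (Φ : SMap A B) (S T : Matrix R R ℂ) (X : Matrix (A × R) (A × R) ℂ) :
    tensorId R Φ (((1 : Matrix A A ℂ) ⊗ₖ S) * X * ((1 : Matrix A A ℂ) ⊗ₖ T)) =
      ((1 : Matrix B B ℂ) ⊗ₖ S) * tensorId R Φ X * ((1 : Matrix B B ℂ) ⊗ₖ T) := by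
  refine ext_blockSnd fun r r' => ?_
  rw [blockSnd_tensorId, blockSnd_conj_one_kronecker, blockSnd_conj_one_kronecker]
  simp only [map_sum, map_smul, blockSnd_tensorId]

end Maps

/-! ### Duality for the diamond norm -/

section Diamond

variable {A B : Type*} [Fintype A] [DecidableEq A] [Fintype B] [DecidableEq B]

omit [Fintype A] [DecidableEq A] [DecidableEq B] in
theorem partialTraceFst_add (X Y : Matrix (B × A) (B × A) ℂ) :
    partialTraceFst (X + Y) = partialTraceFst X + partialTraceFst Y := by
  ext a a'
  simp [partialTraceFst, Finset.sum_add_distrib]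

omit [Fintype A] [DecidableEq A] [DecidableEq B] in
theorem partialTraceFst_smul (c : ℂ) (X : Matrix (B × A) (B × A) ℂ) :
    partialTraceFst (c • X) = c • partialTraceFst X := by
  ext a a'
  simp [partialTraceFst, Finset.mul_sum]

omit [Fintype A] [DecidableEq A] in
theorem partialTraceFst_one_kronecker (Z : Matrix A A ℂ) :
    partialTraceFst ((1 : Matrix B B ℂ) ⊗ₖ Z) = (Fintype.card B : ℂ) • Z := by
  ext a a'
  simp [partialTraceFst]

omit [DecidableEq A] in
theorem trace_mul_partialTraceFst (Z : Matrix A A ℂ) (Y : Matrix (B × A) (B × A) ℂ) :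
    (Z * partialTraceFst Y).trace = (((1 : Matrix B B ℂ) ⊗ₖ Z) * Y).trace := by
  have h1 : partialTraceFst Y = ∑ b, blockFst Y b b := by
    ext a a'
    simp [partialTraceFst, blockFst, Matrix.sum_apply]
  have h2 : ∀ b b', blockFst ((1 : Matrix B B ℂ) ⊗ₖ Z) b b' = if b = b' then Z else 0 := by
    intro b b'
    ext a a'
    by_cases h : b = b' <;> simp [blockFst, h]
  rw [h1, trace_mul_eq_sum_blockFst, Matrix.mul_sum, Matrix.trace_sum]
  refine Finset.sum_congr rfl fun b _ => ?_
  rw [Finset.sum_eq_single b (fun b' _ hb => by rw [h2, if_neg hb.symm, Matrix.zero_mul,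
    Matrix.trace_zero]) (by simp), h2, if_pos rfl]

omit [DecidableEq B] in
theorem trace_apply_eq_sum (Φ : SMap A B) (X : Matrix A A ℂ) :
    (Φ X).trace = ∑ a, ∑ a', X a a' * partialTraceFst (choi Φ) a a' := by
  simp only [Matrix.trace, Matrix.diag, apply_eq_sum_choi Φ X, partialTraceFst, Matrix.of_apply,
    Finset.mul_sum]
  rw [Finset.sum_comm]
  exact Finset.sum_congr rfl fun a _ => Finset.sum_comm

omit [DecidableEq B] in
theorem isChannel_of_choi {Φ : SMap A B} (h : (choi Φ).PosSemidef)
    (h1 : partialTraceFst (choi Φ) = 1) : IsChannel Φ :=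
  ⟨isCompletelyPositive_of_choi h, fun X => by
    rw [trace_apply_eq_sum, h1]
    simp [Matrix.one_apply, Matrix.trace]⟩

/-- For each state, the image under `Λ ⊗ id` is a positive operator of trace `c` that dominates the
image under `Δ ⊗ id`; `traceNorm_le_of_le` then applies. -/
theorem diamondNorm_le_of_le {Δ Λ : SMap A B} {c : ℝ} (hc : 0 ≤ c)
    (hΔ : ∀ X, (Δ X).trace = 0) (hΛ : IsCompletelyPositive Λ)
    (hΛtr : ∀ X, (Λ X).trace = c * X.trace) (h : IsCompletelyPositive (Λ - Δ)) :
    diamondNorm Δ ≤ 2 * c := by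
  refine Real.sSup_le ?_ (by linarith)
  rintro _ ⟨ρ, hρ, rfl⟩
  have h0 : (tensorId A Δ ρ).trace = 0 := by
    rw [trace_tensorId (c := 0) (by simpa using hΔ), zero_mul]
  have h1 := traceNorm_le_of_le h0 (hΛ.tensorId_posSemidef hρ.1) (h.tensorId_posSemidef hρ.1)
  rw [trace_tensorId hΛtr, hρ.2, mul_one, Complex.ofReal_re] at h1
  exact h1

theorem traceNorm_tensorId_le_diamondNorm {Φ Ψ : SMap A B} (hΦ : IsChannel Φ) (hΨ : IsChannel Ψ)
    {ρ : Matrix (A × A) (A × A) ℂ} (hρ : IsState ρ) :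
    traceNorm (tensorId A (Φ - Ψ) ρ) ≤ diamondNorm (Φ - Ψ) := by
  -- The bound `2` makes the real supremum genuine: an unbounded set would have supremum `0`.
  refine le_csSup ⟨2, ?_⟩ ⟨ρ, hρ, rfl⟩
  rintro _ ⟨ρ, hρ, rfl⟩
  have h1 := hΦ.isState_tensorId (R := A) hρ
  have h2 := hΨ.isState_tensorId (R := A) hρ
  have h := traceNorm_le_of_le (H := tensorId A (Φ - Ψ) ρ) (K := tensorId A Φ ρ)
    (by rw [tensorId_sub, LinearMap.sub_apply, Matrix.trace_sub, h1.2, h2.2, sub_self]) h1.1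
    (by rw [tensorId_sub, LinearMap.sub_apply, sub_sub_cancel]; exact h2.1)
  rw [h1.2, Complex.one_re, mul_one] at h
  exact h

theorem diamondNorm_nonneg (Φ : SMap A B) : 0 ≤ diamondNorm Φ := by
  refine Real.sSup_nonneg ?_
  rintro _ ⟨ρ, -, rfl⟩
  exact Finset.sum_nonneg fun i _ => Real.sqrt_nonneg _

theorem trace_entangled_mul_one_kronecker (Z : Matrix A A ℂ) :
    (entangled A * ((1 : Matrix A A ℂ) ⊗ₖ Z)).trace = Z.trace := by
  simp [Matrix.trace, Matrix.mul_apply, entangled, Matrix.vecMulVec_apply, Fintype.sum_prod_type,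
    Matrix.one_apply]

/-- Conjugation by `1 ⊗ S⁻¹` turns `X ≤ 1 ⊗ SᴴS` into `P ≤ 1`. This converts a pair `(X, SᴴS)` of
dual variables into a measurement effect `P` and an operator `S` to be applied to the input. -/
theorem exists_contraction_of_le_one_kronecker {X : Matrix (B × A) (B × A) ℂ}
    (hX : X.PosSemidef) {S : Matrix A A ℂ} (hS : IsUnit S.det)
    (h : ((1 : Matrix B B ℂ) ⊗ₖ (S.conjTranspose * S) - X).PosSemidef) :
    ∃ P : Matrix (B × A) (B × A) ℂ, P.PosSemidef ∧ (1 - P).PosSemidef ∧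
      X = ((1 : Matrix B B ℂ) ⊗ₖ S.conjTranspose) * P * ((1 : Matrix B B ℂ) ⊗ₖ S) := by
  have hST : S * S⁻¹ = 1 := Matrix.mul_nonsing_inv S hS
  have hTS : S⁻¹ * S = 1 := Matrix.nonsing_inv_mul S hS
  generalize S⁻¹ = T at hST hTS
  have hct : ∀ Z : Matrix A A ℂ, ((1 : Matrix B B ℂ) ⊗ₖ Z).conjTranspose =
      (1 : Matrix B B ℂ) ⊗ₖ Z.conjTranspose := fun Z => by
    rw [Matrix.conjTranspose_kronecker, Matrix.conjTranspose_one]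
  have hmul : ∀ Y Z : Matrix A A ℂ, ((1 : Matrix B B ℂ) ⊗ₖ Y) * ((1 : Matrix B B ℂ) ⊗ₖ Z) =
      (1 : Matrix B B ℂ) ⊗ₖ (Y * Z) := fun Y Z => by
    rw [← Matrix.mul_kronecker_mul, Matrix.one_mul]
  refine ⟨((1 : Matrix B B ℂ) ⊗ₖ T).conjTranspose * X * ((1 : Matrix B B ℂ) ⊗ₖ T),
    hX.conjTranspose_mul_mul_same _, ?_, ?_⟩
  · have h1 := h.conjTranspose_mul_mul_same ((1 : Matrix B B ℂ) ⊗ₖ T)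
    have h2 : ((1 : Matrix B B ℂ) ⊗ₖ T).conjTranspose *
        ((1 : Matrix B B ℂ) ⊗ₖ (S.conjTranspose * S)) * ((1 : Matrix B B ℂ) ⊗ₖ T) = 1 := by
      rw [hct, hmul, hmul, Matrix.mul_assoc, Matrix.mul_assoc, hST, Matrix.mul_one,
        ← Matrix.conjTranspose_mul, hST, Matrix.conjTranspose_one, Matrix.one_kronecker_one]
    rwa [Matrix.mul_sub, Matrix.sub_mul, h2] at h1
  · have h3 : ((1 : Matrix B B ℂ) ⊗ₖ T) * ((1 : Matrix B B ℂ) ⊗ₖ S) = 1 := by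
      rw [hmul, hTS, Matrix.one_kronecker_one]
    have h4 : ((1 : Matrix B B ℂ) ⊗ₖ S.conjTranspose) *
        ((1 : Matrix B B ℂ) ⊗ₖ T).conjTranspose = 1 := by
      rw [hct, hmul, ← Matrix.conjTranspose_mul, hTS, Matrix.conjTranspose_one,
        Matrix.one_kronecker_one]
    calc X = (((1 : Matrix B B ℂ) ⊗ₖ S.conjTranspose) *
          ((1 : Matrix B B ℂ) ⊗ₖ T).conjTranspose) * X *
            (((1 : Matrix B B ℂ) ⊗ₖ T) * ((1 : Matrix B B ℂ) ⊗ₖ S)) := by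
          rw [h3, h4, Matrix.one_mul, Matrix.mul_one]
      _ = _ := by simp only [Matrix.mul_assoc]

theorem trace_conj_mul_comm {n : Type*} [Fintype n] (K J L P : Matrix n n ℂ) :
    (K * J * L * P).trace = (L * P * K * J).trace := by
  rw [Matrix.mul_assoc (K * J), Matrix.trace_mul_comm, ← Matrix.mul_assoc]

/-- With `ρ = SᴴS` and `X = (1 ⊗ Sᴴ) P (1 ⊗ S)`, the factors `S` are moved from `X` onto the
maximally entangled input. The resulting `ω` has trace `Tr ρ`, and after normalization `P` is an
effect that tests the difference of the two output states. -/
theorem re_trace_mul_choi_le_of_posDef [Nonempty A] {Φ Ψ : SMap A B} (hΦ : IsChannel Φ)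
    (hΨ : IsChannel Ψ) {X : Matrix (B × A) (B × A) ℂ} (hX : X.PosSemidef) {ρ : Matrix A A ℂ}
    (hρ : ρ.PosDef) (h : ((1 : Matrix B B ℂ) ⊗ₖ ρ - X).PosSemidef) :
    2 * (X * choi (Φ - Ψ)).trace.re ≤ diamondNorm (Φ - Ψ) * ρ.trace.re := by
  obtain ⟨S, hS⟩ := hρ.posSemidef.exists_eq_conjTranspose_mul_self
  have hSdet : IsUnit S.det := by
    have h1 := hρ.det_pos.ne'
    rw [hS, Matrix.det_mul] at h1
    exact (right_ne_zero_of_mul h1).isUnit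
  obtain ⟨P, hP, hP1, hXP⟩ := exists_contraction_of_le_one_kronecker hX hSdet (by rwa [← hS])
  obtain ⟨ω, hω, hωtr, hωval⟩ : ∃ ω : Matrix (A × A) (A × A) ℂ, ω.PosSemidef ∧
      ω.trace = ρ.trace ∧ (tensorId A (Φ - Ψ) ω * P).trace = (X * choi (Φ - Ψ)).trace := by
    refine ⟨((1 : Matrix A A ℂ) ⊗ₖ S) * entangled A * ((1 : Matrix A A ℂ) ⊗ₖ S.conjTranspose),
      ?_, ?_, ?_⟩
    · have := (entangled_posSemidef (A := A)).mul_mul_conjTranspose_same ((1 : Matrix A A ℂ) ⊗ₖ S)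
      rwa [Matrix.conjTranspose_kronecker, Matrix.conjTranspose_one] at this
    · rw [Matrix.trace_mul_comm, ← Matrix.mul_assoc, ← Matrix.mul_kronecker_mul, Matrix.one_mul,
        ← hS, Matrix.trace_mul_comm, trace_entangled_mul_one_kronecker]
    · rw [tensorId_conj, tensorId_entangled, hXP, trace_conj_mul_comm]
  obtain ⟨t, htre, ht⟩ : ∃ t : ℝ, 0 < t ∧ ρ.trace = (t : ℂ) := by
    obtain ⟨htre, htim⟩ := Complex.pos_iff.mp hρ.trace_pos
    exact ⟨_, htre, Complex.ext rfl (by simpa using htim.symm)⟩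
  have hstate : IsState ((t⁻¹ : ℂ) • ω) := by
    refine ⟨hω.smul ?_, ?_⟩
    · rw [← Complex.ofReal_inv]
      exact Complex.zero_le_real.mpr (inv_nonneg.mpr htre.le)
    · rw [Matrix.trace_smul, hωtr, ht, smul_eq_mul, inv_mul_cancel₀]
      exact_mod_cast htre.ne'
  have hle := traceNorm_tensorId_le_diamondNorm hΦ hΨ hstate
  have h1 := hΦ.isState_tensorId (R := A) hstate
  have h2 := hΨ.isState_tensorId (R := A) hstate
  have hH := two_mul_re_trace_mul_le_traceNorm (H := tensorId A (Φ - Ψ) ((t⁻¹ : ℂ) • ω))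
    (by rw [tensorId_sub]; exact h1.1.1.sub h2.1.1)
    (by rw [tensorId_sub, LinearMap.sub_apply, Matrix.trace_sub, h1.2, h2.2, sub_self]) hP hP1
  have hval : (tensorId A (Φ - Ψ) ((t⁻¹ : ℂ) • ω) * P).trace =
      (t⁻¹ : ℂ) * (X * choi (Φ - Ψ)).trace := by
    rw [map_smul, Matrix.smul_mul, Matrix.trace_smul, hωval, smul_eq_mul]
  have := hH.trans hle
  rw [hval, ← Complex.ofReal_inv, Complex.re_ofReal_mul] at this
  rw [← mul_assoc, mul_comm 2, mul_assoc, inv_mul_le_iff₀ htre] at this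
  rw [ht, Complex.ofReal_re]
  linarith

theorem re_trace_mul_choi_le [Nonempty A] {Φ Ψ : SMap A B} (hΦ : IsChannel Φ)
    (hΨ : IsChannel Ψ) {X : Matrix (B × A) (B × A) ℂ} (hX : X.PosSemidef) {ρ : Matrix A A ℂ}
    (hρ : ρ.PosSemidef) (h : ((1 : Matrix B B ℂ) ⊗ₖ ρ - X).PosSemidef) :
    2 * (X * choi (Φ - Ψ)).trace.re ≤ diamondNorm (Φ - Ψ) * ρ.trace.re := by
  refine le_of_forall_pos_le_add fun δ hδ => ?_
  set D := diamondNorm (Φ - Ψ)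
  have hD : 0 ≤ D := diamondNorm_nonneg _
  have hpos : 0 < D * Fintype.card A + 1 := by positivity
  -- Replacing `ρ` by the invertible `ρ + τ • 1` costs `D * τ * dim A ≤ δ`; the `+ 1` avoids
  -- division by zero.
  set τ := δ / (D * Fintype.card A + 1)
  have hτ : 0 < τ := div_pos hδ hpos
  have hτ' : (0 : ℂ) < (τ : ℂ) := by exact_mod_cast hτ
  have h1 := re_trace_mul_choi_le_of_posDef hΦ hΨ hX (ρ := ρ + (τ : ℂ) • 1)
    (Matrix.PosDef.posSemidef_add hρ (Matrix.PosDef.one.smul hτ')) (by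
      have : (1 : Matrix B B ℂ) ⊗ₖ (ρ + (τ : ℂ) • 1) - X =
          ((1 : Matrix B B ℂ) ⊗ₖ ρ - X) + (τ : ℂ) • 1 := by
        rw [Matrix.kronecker_add, Matrix.kronecker_smul, Matrix.one_kronecker_one]
        abel
      rw [this]
      exact h.add (Matrix.PosSemidef.one.smul hτ'.le))
  refine h1.trans ?_
  rw [Matrix.trace_add, Matrix.trace_smul, Matrix.trace_one, smul_eq_mul, Complex.add_re,
    Complex.re_ofReal_mul, Complex.natCast_re, mul_add]
  have h2 : τ * (D * Fintype.card A + 1) = δ := div_mul_cancel₀ _ hpos.ne'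
  change D * _ + D * _ ≤ D * _ + δ
  nlinarith

/-- Strong duality for the diamond norm of a difference of channels. -/
theorem exists_channel_isCompletelyPositive_sub [Nonempty A] [Nonempty B] {Φ Ψ : SMap A B}
    (hΦ : IsChannel Φ) (hΨ : IsChannel Ψ) {c : ℝ} (hc : diamondNorm (Φ - Ψ) < 2 * c) :
    ∃ γ : SMap A B, IsChannel γ ∧ IsCompletelyPositive ((c : ℂ) • γ - (Φ - Ψ)) := by
  set D := diamondNorm (Φ - Ψ)
  have hD : 0 ≤ D := diamondNorm_nonneg _
  set J := choi (Φ - Ψ) with hJdef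
  have hJ : J.IsHermitian := by
    rw [hJdef, map_sub]
    exact hΦ.1.choi_posSemidef.1.sub hΨ.1.choi_posSemidef.1
  -- Block matrices merge the constraints `J ≤ Y` and `Tr_B Y ≤ (D/2) 1` into the single inequality
  -- `diag(J, -(D/2) 1) ≤ diag(Y, -Tr_B Y)`.
  set C : Set (Matrix ((B × A) ⊕ A) ((B × A) ⊕ A) ℂ) :=
    {k | ∃ Y : Matrix (B × A) (B × A) ℂ, Y.PosSemidef ∧
      k = Matrix.fromBlocks Y 0 0 ((-1 : ℂ) • partialTraceFst Y)} with hC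
  have hptr : ∀ Y : Matrix (B × A) (B × A) ℂ, Y.PosSemidef → (partialTraceFst Y).PosSemidef := by
    intro Y hY
    refine Matrix.posSemidef_of_trace_mul_nonneg fun Z hZ => ?_
    rw [trace_mul_partialTraceFst]
    exact (Matrix.PosSemidef.one.kronecker hZ).trace_mul_nonneg hY
  have htr : ∀ (X : Matrix ((B × A) ⊕ A) ((B × A) ⊕ A) ℂ) (Y : Matrix (B × A) (B × A) ℂ)
      (Z : Matrix A A ℂ), (X * Matrix.fromBlocks Y 0 0 Z).trace =
        (X.toBlocks₁₁ * Y).trace + (X.toBlocks₂₂ * Z).trace := by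
    intro X Y Z
    conv_lhs => rw [← Matrix.fromBlocks_toBlocks X]
    rw [Matrix.fromBlocks_multiply]
    simp [Matrix.trace, Fintype.sum_sum_type]
  have hd : (0 : ℝ) < 1 + Fintype.card B := by positivity
  -- The error enters twice: `η` in the bound on `Tr_B Y`, and `η * dim B` from the partial trace of
  -- `η • 1`. Together they fill the gap `c - D / 2`.
  set η : ℝ := (c - D / 2) / (1 + Fintype.card B)
  have hη : 0 < η := div_pos (by linarith) hd
  obtain ⟨_, ⟨Y, hY, rfl⟩, hpos⟩ := exists_mem_convex_posSemidef_add_smul_one_sub (C := C)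
    (H := Matrix.fromBlocks J 0 0 ((-(D / 2) : ℂ) • 1)) (η := η)
    (by
      rintro _ ⟨Y, hY, rfl⟩ _ ⟨Y', hY', rfl⟩ a b ha hb hab
      refine ⟨a • Y + b • Y', (hY.smul ha).add (hY'.smul hb), ?_⟩
      rw [Matrix.fromBlocks_smul, Matrix.fromBlocks_smul, Matrix.fromBlocks_add,
        ← Complex.coe_smul a, ← Complex.coe_smul b, partialTraceFst_add, partialTraceFst_smul,
        partialTraceFst_smul]
      congr 1
      · simp
      · simp
      · rw [smul_add, smul_comm, smul_comm (-1 : ℂ) (b : ℂ)]; rfl)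
    ⟨_, 0, Matrix.PosSemidef.zero, rfl⟩
    (by
      rintro _ ⟨Y, hY, rfl⟩
      refine Matrix.IsHermitian.fromBlocks hY.1 (by simp) ?_
      have := (hptr Y hY).1.neg
      rwa [neg_one_smul])
    (by
      refine Matrix.IsHermitian.fromBlocks hJ (by simp) ?_
      rw [Matrix.IsHermitian, Matrix.conjTranspose_smul, Matrix.conjTranspose_one]
      simp)
    (by
      intro X hX s hs
      have hX1 : X.toBlocks₁₁.PosSemidef := hX.submatrix Sum.inl
      have hX2 : X.toBlocks₂₂.PosSemidef := hX.submatrix Sum.inr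
      have hs' : ∀ Y : Matrix (B × A) (B × A) ℂ, Y.PosSemidef →
          -s ≤ (Y * ((1 : Matrix B B ℂ) ⊗ₖ X.toBlocks₂₂ - X.toBlocks₁₁)).trace.re := by
        intro Y hY
        have := hs _ ⟨Y, hY, rfl⟩
        rw [htr, Matrix.mul_smul, Matrix.trace_smul, trace_mul_partialTraceFst,
          Matrix.trace_mul_comm _ Y, Matrix.trace_mul_comm _ Y] at this
        rw [Matrix.mul_sub, Matrix.trace_sub, Complex.sub_re]
        simp only [neg_smul, one_smul, Complex.add_re, Complex.neg_re] at this
        linarith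
      have hs0 : 0 ≤ s := by simpa using hs' 0 Matrix.PosSemidef.zero
      -- A linear functional bounded below on a cone is nonnegative there: rescaling a negative
      -- value to `-(s + 1)` violates `hs'`.
      have hdom : ((1 : Matrix B B ℂ) ⊗ₖ X.toBlocks₂₂ - X.toBlocks₁₁).PosSemidef := by
        refine Matrix.posSemidef_of_re_trace_mul_nonneg
          ((Matrix.PosSemidef.one.kronecker hX2).1.sub hX1.1) fun Y hY => ?_
        by_contra hneg
        push Not at hneg
        set x := (Y * ((1 : Matrix B B ℂ) ⊗ₖ X.toBlocks₂₂ - X.toBlocks₁₁)).trace.re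
        have ht : 0 ≤ (s + 1) / (-x) := div_nonneg (by linarith) (by linarith)
        have := hs' (((s + 1) / (-x)) • Y) (hY.smul ht)
        rw [Matrix.smul_mul, Matrix.trace_smul, Complex.smul_re, smul_eq_mul] at this
        change -s ≤ (s + 1) / (-x) * x at this
        rw [div_neg, neg_mul, div_mul_cancel₀ _ hneg.ne] at this
        linarith
      have := re_trace_mul_choi_le hΦ hΨ hX1 hX2 hdom
      rw [htr, Matrix.mul_smul, Matrix.mul_one, Matrix.trace_smul, Complex.add_re, smul_eq_mul]
      have h2 : ((-(D / 2) : ℂ) * X.toBlocks₂₂.trace).re = -(D / 2) * X.toBlocks₂₂.trace.re := by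
        rw [← Complex.re_ofReal_mul]; push_cast; rfl
      rw [h2]
      change 2 * (X.toBlocks₁₁ * J).trace.re ≤ D * _ at this
      linarith) hη
  have h1 : (Y + (η : ℂ) • 1 - J).PosSemidef := by
    refine (congrArg Matrix.PosSemidef ?_).mpr (hpos.submatrix Sum.inl)
    ext p q
    simp [Matrix.one_apply]
  have h2 : ((η + D / 2 : ℂ) • 1 - partialTraceFst Y).PosSemidef := by
    refine (congrArg Matrix.PosSemidef ?_).mpr (hpos.submatrix Sum.inr)
    ext p q
    simp [Matrix.one_apply]
    split_ifs <;> ring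
  set Q := (η + D / 2 : ℂ) • 1 - partialTraceFst Y with hQ
  -- The last term spreads the deficit `Q` uniformly over `B`, making the partial trace exactly `c •
  -- 1`, so that `c⁻¹ • Z` is the Choi matrix of a channel.
  set Z := Y + (η : ℂ) • 1 + (Fintype.card B : ℂ)⁻¹ • ((1 : Matrix B B ℂ) ⊗ₖ Q) with hZ
  have hηc : (0 : ℂ) ≤ (η : ℂ) := Complex.zero_le_real.mpr hη.le
  have hcard : (Fintype.card B : ℂ) ≠ 0 := by simp
  have hQ' : ((Fintype.card B : ℂ)⁻¹ • ((1 : Matrix B B ℂ) ⊗ₖ Q)).PosSemidef :=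
    (Matrix.PosSemidef.one.kronecker h2).smul (by positivity)
  have hZpos : Z.PosSemidef := (hY.add (Matrix.PosSemidef.one.smul hηc)).add hQ'
  have hc0 : 0 < c := by linarith
  have hc0' : (c : ℂ) ≠ 0 := by exact_mod_cast hc0.ne'
  have hZtr : partialTraceFst Z = (c : ℂ) • 1 := by
    rw [hZ, partialTraceFst_add, partialTraceFst_add, partialTraceFst_smul, partialTraceFst_smul,
      partialTraceFst_one_kronecker, ← Matrix.one_kronecker_one, partialTraceFst_one_kronecker,
      inv_smul_smul₀ hcard, hQ, smul_smul]
    have : (c : ℂ) = η * Fintype.card B + (η + D / 2) := by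
      have : η * (1 + Fintype.card B) = c - D / 2 := div_mul_cancel₀ _ hd.ne'
      have : c = η * Fintype.card B + (η + D / 2) := by linarith
      exact_mod_cast this
    rw [this]
    simp only [add_smul]
    abel
  refine ⟨ofChoi ((c : ℂ)⁻¹ • Z), isChannel_of_choi ?_ ?_, isCompletelyPositive_of_choi ?_⟩
  · rw [choi_ofChoi]
    refine hZpos.smul ?_
    rw [← Complex.ofReal_inv]
    exact Complex.zero_le_real.mpr (inv_nonneg.mpr hc0.le)
  · rw [choi_ofChoi, partialTraceFst_smul, hZtr, inv_smul_smul₀ hc0']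
  · rw [map_sub, map_smul, choi_ofChoi, smul_inv_smul₀ hc0']
    have : Z - choi (Φ - Ψ) = (Y + (η : ℂ) • 1 - J) +
        (Fintype.card B : ℂ)⁻¹ • ((1 : Matrix B B ℂ) ⊗ₖ Q) := by
      rw [hZ]; abel
    rw [this]
    exact h1.add hQ'

end Diamond

/-! ### Guessing games played with nearby channels -/

section Games

variable {A B R : Type*} [Fintype A] [DecidableEq A] [Fintype B] [DecidableEq B]
  [Fintype R] [DecidableEq R]

theorem traceNorm_neg (X : Matrix A A ℂ) : traceNorm (-X) = traceNorm X := by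
  simp only [traceNorm, Matrix.conjTranspose_neg, Matrix.neg_mul, Matrix.mul_neg, neg_neg]

theorem diamondNorm_sub_comm (Φ Ψ : SMap A B) : diamondNorm (Φ - Ψ) = diamondNorm (Ψ - Φ) := by
  have h : ∀ ρ : Matrix (A × A) (A × A) ℂ,
      traceNorm (tensorId A (Φ - Ψ) ρ) = traceNorm (tensorId A (Ψ - Φ) ρ) := fun ρ => by
    rw [← traceNorm_neg, tensorId_sub, tensorId_sub, LinearMap.sub_apply, LinearMap.sub_apply,
      neg_sub]
  simp only [diamondNorm, h]

omit [Fintype A] in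
theorem IsMeasurement.one_sub_posSemidef {k : ℕ} {M : Fin k → Matrix A A ℂ}
    (hM : IsMeasurement M) (i : Fin k) : (1 - M i).PosSemidef := by
  rw [← hM.2, ← Finset.add_sum_erase _ _ (Finset.mem_univ i), add_sub_cancel_left]
  exact Matrix.posSemidef_sum _ fun j _ => hM.1 j

theorem successProb_le_one {k : ℕ} (E : Ensemble A k) {M : Fin k → Matrix A A ℂ}
    (hM : IsMeasurement M) : successProb E.prob E.state M ≤ 1 := by
  rw [← E.sum_prob]
  refine Finset.sum_le_sum fun i _ => mul_le_of_le_one_right (E.prob_nonneg i) ?_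
  have h := (Complex.nonneg_iff.mp ((E.isState i).1.trace_mul_nonneg (hM.one_sub_posSemidef i))).1
  rw [Matrix.mul_sub, Matrix.mul_one, Matrix.trace_sub, (E.isState i).2, Complex.sub_re,
    Complex.one_re] at h
  linarith

theorem successProb_le_optSuccess {k : ℕ} (E : Ensemble A k) {M : Fin k → Matrix A A ℂ}
    (hM : IsMeasurement M) : successProb E.prob E.state M ≤ E.optSuccess := by
  refine le_csSup ⟨1, ?_⟩ ⟨M, hM, rfl⟩
  rintro _ ⟨N, hN, rfl⟩
  exact successProb_le_one E hN

/-- The adjoint of a channel is unital and positive after tensoring with the identity, so the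
channel can be absorbed into the measurement. -/
theorem successProb_tensorId_le_optSuccess {k : ℕ} (E : Ensemble (A × R) k) {Ψ : SMap A B}
    (hΨ : IsChannel Ψ) {M : Fin k → Matrix (B × R) (B × R) ℂ} (hM : IsMeasurement M) :
    successProb E.prob (fun i => tensorId R Ψ (E.state i)) M ≤ E.optSuccess := by
  have hadj := (isTraceAdjoint_adjointMap Ψ).tensorId_right (R := R)
  have hN : IsMeasurement fun i => tensorId R (adjointMap Ψ) (M i) := by
    refine ⟨fun i => Matrix.posSemidef_of_trace_mul_nonneg fun Y hY => ?_, ?_⟩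
    · rw [← hadj]
      exact (hΨ.1.tensorId_posSemidef hY).trace_mul_nonneg (hM.1 i)
    · rw [← map_sum, hM.2, Matrix.ext_iff_trace_mul_left]
      intro X
      rw [← hadj, Matrix.mul_one, Matrix.mul_one,
        trace_tensorId (c := 1) (by simpa using hΨ.2), one_mul]
  refine le_trans (le_of_eq ?_) (successProb_le_optSuccess E hN)
  simp only [successProb, hadj _ _]

/-- The guessing probabilities achieved with two channels differ at most by half their diamond
distance times the optimal guessing probability. -/
theorem successProb_le_add_mul_optSuccess {C U : Type*} [Fintype C] [DecidableEq C] [Fintype U]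
    [DecidableEq U] [Nonempty A] [Nonempty B]
    {Φ Ψ : SMap A B} (hΦ : IsChannel Φ) (hΨ : IsChannel Ψ) {c : ℝ}
    (hc : diamondNorm (Ψ - Φ) < 2 * c) {α : SMap C (U × A)} (hα : IsChannel α) {k : ℕ}
    (E : Ensemble (C × R) k) {M : Fin k → Matrix ((U × B) × R) ((U × B) × R) ℂ}
    (hM : IsMeasurement M) :
    successProb E.prob (fun i => tensorId R (idTensor U Φ ∘ₗ α) (E.state i)) M ≤
      successProb E.prob (fun i => tensorId R (idTensor U Ψ ∘ₗ α) (E.state i)) M +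
        c * E.optSuccess := by
  rw [diamondNorm_sub_comm] at hc
  have hc0 : 0 ≤ c := by linarith [diamondNorm_nonneg (Φ - Ψ)]
  obtain ⟨γ, hγ, hpos⟩ := exists_channel_isCompletelyPositive_sub hΦ hΨ hc
  refine le_trans ?_ (add_le_add_right (mul_le_mul_of_nonneg_left
    (successProb_tensorId_le_optSuccess E (hγ.idTensor_left.comp hα) hM) hc0) _)
  rw [successProb, successProb, successProb, Finset.mul_sum, ← Finset.sum_add_distrib]
  refine Finset.sum_le_sum fun i _ => ?_
  have h1 := (Complex.nonneg_iff.mp (((hpos.idTensor_left (U := U)).comp hα.1).tensorId_posSemidef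
    (E.isState i).1 |>.trace_mul_nonneg (hM.1 i))).1
  have h2 : tensorId R (idTensor U ((c : ℂ) • γ - (Φ - Ψ)) ∘ₗ α) (E.state i) =
      (c : ℂ) • tensorId R (idTensor U γ ∘ₗ α) (E.state i) -
        (tensorId R (idTensor U Φ ∘ₗ α) (E.state i) -
          tensorId R (idTensor U Ψ ∘ₗ α) (E.state i)) := by
    rw [map_sub, map_smul, map_sub]
    rfl
  rw [h2, Matrix.sub_mul, Matrix.sub_mul, Matrix.smul_mul, Matrix.trace_sub, Matrix.trace_sub,
    Matrix.trace_smul, smul_eq_mul, Complex.sub_re, Complex.sub_re, Complex.re_ofReal_mul] at h1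
  nlinarith [mul_le_mul_of_nonneg_left h1 (E.prob_nonneg i)]

end Games

/-! ### Teleportation and the Pauli ensemble -/

section Teleportation

variable {A B R : Type*} [Fintype A] [DecidableEq A] [Fintype B] [DecidableEq B]
  [Fintype R] [DecidableEq R]

theorem maxEntangled_eq_smul_entangled :
    maxEntangled R = (Fintype.card R : ℂ)⁻¹ • entangled R := by
  ext p q
  by_cases hp : p.1 = p.2 <;> by_cases hq : q.1 = q.2 <;>
    simp [maxEntangled, entangled, Matrix.vecMulVec_apply, hp, hq]

/-- The maximally entangled vector satisfies `(W ⊗ 1)Ω = (1 ⊗ Wᵀ)Ω`. This explains the transposes in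
`conjTransposeSnd`. -/
theorem kronecker_one_conj_entangled (W : Matrix R R ℂ) :
    (W ⊗ₖ (1 : Matrix R R ℂ)) * entangled R * (W ⊗ₖ (1 : Matrix R R ℂ)).conjTranspose =
      ((1 : Matrix R R ℂ) ⊗ₖ W.transpose) * entangled R *
        ((1 : Matrix R R ℂ) ⊗ₖ W.transpose).conjTranspose := by
  have h : ∀ v : R × R → ℂ, v = (fun p => if p.1 = p.2 then 1 else 0) →
      (W ⊗ₖ (1 : Matrix R R ℂ)).mulVec v = ((1 : Matrix R R ℂ) ⊗ₖ W.transpose).mulVec v := by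
    rintro _ rfl
    ext p
    simp [Matrix.mulVec, dotProduct, Fintype.sum_prod_type, Matrix.one_apply]
  have hstar : star (fun p : R × R => if p.1 = p.2 then (1 : ℂ) else 0) =
      fun p => if p.1 = p.2 then 1 else 0 := by
    funext p
    simp [apply_ite]
  simp only [entangled, Matrix.mul_vecMulVec, Matrix.vecMulVec_mul, Matrix.vecMul_conjTranspose,
    hstar, h _ rfl]

theorem kronecker_one_conj_maxEntangled (W : Matrix R R ℂ) :
    (W ⊗ₖ (1 : Matrix R R ℂ)) * maxEntangled R * (W ⊗ₖ (1 : Matrix R R ℂ)).conjTranspose =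
      ((1 : Matrix R R ℂ) ⊗ₖ W.transpose) * maxEntangled R *
        ((1 : Matrix R R ℂ) ⊗ₖ W.transpose).conjTranspose := by
  simp only [maxEntangled_eq_smul_entangled, Matrix.mul_smul, Matrix.smul_mul,
    kronecker_one_conj_entangled]

/-- Conjugation of the second tensor factor by the transpose of `W`. -/
def conjTransposeSnd (W : Matrix R R ℂ) (X : Matrix (A × R) (A × R) ℂ) :
    Matrix (A × R) (A × R) ℂ :=
  ((1 : Matrix A A ℂ) ⊗ₖ W.transpose) * X * ((1 : Matrix A A ℂ) ⊗ₖ W.transpose).conjTranspose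

omit [DecidableEq R] in
theorem tensorId_conjTransposeSnd (Φ : SMap A B) (W : Matrix R R ℂ)
    (X : Matrix (A × R) (A × R) ℂ) :
    tensorId R Φ (conjTransposeSnd W X) = conjTransposeSnd W (tensorId R Φ X) := by
  simp only [conjTransposeSnd, Matrix.conjTranspose_kronecker, Matrix.conjTranspose_one,
    tensorId_conj]

theorem one_kronecker_transpose_unitary {W : Matrix R R ℂ} (hW : W ∈ Matrix.unitaryGroup R ℂ) :
    ((1 : Matrix A A ℂ) ⊗ₖ W.transpose).conjTranspose * ((1 : Matrix A A ℂ) ⊗ₖ W.transpose) =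
      1 := by
  have h1 : W.transpose.conjTranspose * W.transpose = 1 := by
    change W.conjTranspose.transpose * W.transpose = 1
    rw [← Matrix.transpose_mul]
    have := Matrix.mem_unitaryGroup_iff.mp hW
    rw [Matrix.star_eq_conjTranspose] at this
    rw [this, Matrix.transpose_one]
  rw [Matrix.conjTranspose_kronecker, Matrix.conjTranspose_one, ← Matrix.mul_kronecker_mul, h1,
    Matrix.one_mul, Matrix.one_kronecker_one]

theorem trace_conjTransposeSnd_mul {W : Matrix R R ℂ} (hW : W ∈ Matrix.unitaryGroup R ℂ)
    (X Y : Matrix (A × R) (A × R) ℂ) :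
    (conjTransposeSnd W X * conjTransposeSnd W Y).trace = (X * Y).trace := by
  have h := one_kronecker_transpose_unitary (A := A) hW
  unfold conjTransposeSnd
  generalize (1 : Matrix A A ℂ) ⊗ₖ W.transpose = V at h
  calc (V * X * V.conjTranspose * (V * Y * V.conjTranspose)).trace
      = (V * X * (V.conjTranspose * V) * Y * V.conjTranspose).trace := by
        simp only [Matrix.mul_assoc]
    _ = (V.conjTranspose * V * X * Y).trace := by
        rw [h, Matrix.mul_one, Matrix.trace_mul_comm]
        simp only [← Matrix.mul_assoc, h, Matrix.one_mul]
    _ = _ := by rw [h, Matrix.one_mul]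

theorem trace_mul_bell {W : Fin (Fintype.card R ^ 2) → Matrix R R ℂ} (hW : IsPauliBasis W)
    (X : Matrix (R × R) (R × R) ℂ) (x : Fin (Fintype.card R ^ 2)) :
    (conjTransposeSnd (W x) X * bell W x).trace = (X * maxEntangled R).trace := by
  rw [bell, kronecker_one_conj_maxEntangled]
  exact trace_conjTransposeSnd_mul (hW.1 x) X _

theorem IsState.conjTransposeSnd {W : Matrix R R ℂ} (hW : W ∈ Matrix.unitaryGroup R ℂ)
    {ρ : Matrix (A × R) (A × R) ℂ} (hρ : IsState ρ) : IsState (conjTransposeSnd W ρ) :=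
  ⟨hρ.1.mul_mul_conjTranspose_same _, by
    rw [ChannelComparison.conjTransposeSnd, Matrix.trace_mul_comm, ← Matrix.mul_assoc,
      one_kronecker_transpose_unitary hW, Matrix.one_mul, hρ.2]⟩

/-- The ensemble of the states obtained from `ρ` by applying generalized Pauli unitaries to the
second tensor factor, with uniform probabilities. -/
noncomputable def pauliEnsemble [Nonempty R] {W : Fin (Fintype.card R ^ 2) → Matrix R R ℂ}
    (hW : IsPauliBasis W) {ρ : Matrix (A × R) (A × R) ℂ} (hρ : IsState ρ) :
    Ensemble (A × R) (Fintype.card R ^ 2) where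
  prob _ := ((Fintype.card R : ℝ) ^ 2)⁻¹
  state x := conjTransposeSnd (W x) ρ
  prob_nonneg _ := by positivity
  sum_prob := by
    rw [Finset.sum_const, Finset.card_univ, Fintype.card_fin, nsmul_eq_mul, Nat.cast_pow]
    exact mul_inv_cancel₀ (by positivity)
  isState x := hρ.conjTransposeSnd (hW.1 x)

/-- The map `σ ↦ Tr_{AR}[(σ ⊗ ψ) (N ⊗ 1)]`. -/
noncomputable def steeringMap (N : Matrix (A × R) (A × R) ℂ) : SMap A R :=
  (Fintype.card R : ℂ)⁻¹ • ofChoi (N.transpose.submatrix Prod.swap Prod.swap)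

omit [DecidableEq R] in
theorem choi_steeringMap (N : Matrix (A × R) (A × R) ℂ) :
    choi (steeringMap N) =
      (Fintype.card R : ℂ)⁻¹ • N.transpose.submatrix Prod.swap Prod.swap := by
  rw [steeringMap, map_smul, choi_ofChoi]

omit [Fintype B] [DecidableEq B] in
theorem choi_injective : Function.Injective (choi : SMap A B →ₗ[ℂ] _) := fun Φ Ψ h => by
  refine LinearMap.ext fun X => Matrix.ext fun b b' => ?_
  rw [apply_eq_sum_choi Φ, apply_eq_sum_choi Ψ, h]

omit [DecidableEq A] in
theorem partialTraceFst_eq_steeringMap (σ : Matrix A A ℂ) (N : Matrix (A × R) (A × R) ℂ) :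
    partialTraceFst (relabel (Equiv.prodAssoc A R R).symm (σ ⊗ₖ maxEntangled R) *
      (N ⊗ₖ (1 : Matrix R R ℂ))) = steeringMap N σ := by
  ext r r'
  simp only [partialTraceFst, relabel_apply, maxEntangled, Matrix.mul_apply, Matrix.of_apply,
    Matrix.submatrix_apply, Matrix.kroneckerMap_apply, Equiv.symm_symm, Equiv.prodAssoc_apply,
    Fintype.sum_prod_type, Matrix.one_apply, steeringMap, ofChoi, LinearMap.smul_apply,
    LinearMap.coe_mk, AddHom.coe_mk, Matrix.smul_apply, Matrix.transpose_apply, Prod.swap_prod_mk,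
    smul_eq_mul, ite_and, mul_ite, ite_mul, mul_one, mul_zero, zero_mul, Finset.sum_ite_eq',
    Finset.mem_univ, if_true, Finset.mul_sum, Finset.sum_ite_irrel,
    Finset.sum_const_zero]
  refine Finset.sum_congr rfl fun a _ => Finset.sum_congr rfl fun a' _ => ?_
  ring

omit [DecidableEq A] in
theorem teleport_apply (W : Fin (Fintype.card R ^ 2) → Matrix R R ℂ)
    (M : Fin (Fintype.card R ^ 2) → Matrix (A × R) (A × R) ℂ) (σ : Matrix A A ℂ) :
    teleport W M σ = ∑ x, W x * steeringMap (M x) σ * (W x).conjTranspose := by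
  simp only [← partialTraceFst_eq_steeringMap]
  rfl

omit [DecidableEq R] in
theorem blockSnd_conj_kronecker_one {Q : Type*} [Fintype Q] [DecidableEq Q] (W : Matrix R R ℂ)
    (X : Matrix (R × Q) (R × Q) ℂ) (q q' : Q) :
    blockSnd ((W ⊗ₖ (1 : Matrix Q Q ℂ)) * X * (W ⊗ₖ (1 : Matrix Q Q ℂ)).conjTranspose) q q' =
      W * blockSnd X q q' * W.conjTranspose := by
  ext r r'
  simp only [blockSnd, Matrix.conjTranspose_kronecker, Matrix.conjTranspose_one, Matrix.mul_apply,
    Matrix.of_apply, Fintype.sum_prod_type,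
    Matrix.kroneckerMap_apply, Matrix.one_apply, ite_mul, mul_ite, mul_one, zero_mul, mul_zero,
    Finset.sum_ite_eq, Finset.sum_ite_eq', Finset.mem_univ, if_true]

omit [DecidableEq A] in
theorem tensorId_teleport {Q : Type*} [Fintype Q] [DecidableEq Q]
    (W : Fin (Fintype.card R ^ 2) → Matrix R R ℂ)
    (M : Fin (Fintype.card R ^ 2) → Matrix (A × R) (A × R) ℂ) (X : Matrix (A × Q) (A × Q) ℂ) :
    tensorId Q (teleport W M) X = ∑ x, (W x ⊗ₖ (1 : Matrix Q Q ℂ)) *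
      tensorId Q (steeringMap (M x)) X * (W x ⊗ₖ (1 : Matrix Q Q ℂ)).conjTranspose := by
  refine ext_blockSnd fun q q' => ?_
  have h : ∀ Y : Fin (Fintype.card R ^ 2) → Matrix (R × Q) (R × Q) ℂ,
      blockSnd (∑ x, Y x) q q' = ∑ x, blockSnd (Y x) q q' := fun Y => by
    ext r r'
    simp [blockSnd, Matrix.sum_apply]
  rw [blockSnd_tensorId, teleport_apply, h]
  simp only [blockSnd_conj_kronecker_one, blockSnd_tensorId]

omit [DecidableEq R] in
theorem steeringMap_isCompletelyPositive {N : Matrix (A × R) (A × R) ℂ} (hN : N.PosSemidef) :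
    IsCompletelyPositive (steeringMap N) := by
  refine isCompletelyPositive_of_choi ?_
  rw [choi_steeringMap]
  exact (hN.transpose.submatrix _).smul (by positivity)

/-- The correcting unitaries preserve the trace, and without them the sum over `x` is `steeringMap
1`, with Choi matrix `d⁻¹ • 1`. As `M` is an arbitrary measurement, this also supplies the channels
`γ` of the converse. -/
theorem isChannel_teleport [Nonempty R] {W : Fin (Fintype.card R ^ 2) → Matrix R R ℂ}
    (hW : IsPauliBasis W) {M : Fin (Fintype.card R ^ 2) → Matrix (A × R) (A × R) ℂ}
    (hM : IsMeasurement M) : IsChannel (teleport W M) := by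
  refine ⟨fun n X hX => ?_, fun X => ?_⟩
  · rw [tensorId_teleport]
    exact Matrix.posSemidef_sum _ fun x _ =>
      (steeringMap_isCompletelyPositive (hM.1 x) n X hX).mul_mul_conjTranspose_same _
  · have h1 : ∑ x, steeringMap (M x) = steeringMap 1 := by
      refine choi_injective ?_
      rw [map_sum, ← hM.2]
      simp only [choi_steeringMap]
      ext p q
      simp [Matrix.sum_apply, Finset.mul_sum]
    have h2 : IsChannel (steeringMap (1 : Matrix (A × R) (A × R) ℂ)) := by
      refine isChannel_of_choi (steeringMap_isCompletelyPositive
        Matrix.PosSemidef.one).choi_posSemidef ?_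
      rw [choi_steeringMap, Matrix.transpose_one, Matrix.submatrix_one _ Prod.swap_injective,
        ← Matrix.one_kronecker_one, partialTraceFst_smul, partialTraceFst_one_kronecker,
        inv_smul_smul₀ (by simp)]
    rw [← h2.2, ← h1, teleport_apply, LinearMap.sum_apply, Matrix.trace_sum, Matrix.trace_sum]
    refine Finset.sum_congr rfl fun x _ => ?_
    have := Matrix.mem_unitaryGroup_iff'.mp (hW.1 x)
    rw [Matrix.star_eq_conjTranspose] at this
    rw [Matrix.trace_mul_comm, ← Matrix.mul_assoc, this, Matrix.one_mul]

/-- Writes the overlap as a trace against the Choi matrix; the transpose and swap are invertible and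
preserve positivity, so all positive functionals arise in this way. -/
theorem trace_tensorId_mul_maxEntangled (Φ : SMap A R) (X : Matrix (A × R) (A × R) ℂ) :
    (tensorId R Φ X * maxEntangled R).trace = (Fintype.card R : ℂ)⁻¹ *
      (choi Φ * X.transpose.submatrix Prod.swap Prod.swap).trace := by
  simp only [Matrix.trace, Matrix.diag, Matrix.mul_apply, tensorId_apply_eq_sum_choi, maxEntangled,
    Matrix.of_apply, Matrix.submatrix_apply, Matrix.transpose_apply, Fintype.sum_prod_type,
    Prod.swap_prod_mk, ite_and, mul_ite, mul_zero, Finset.sum_ite_irrel, Finset.sum_const_zero,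
    Finset.sum_ite_eq, Finset.mem_univ, if_true, Finset.sum_mul, Finset.mul_sum]
  refine Finset.sum_congr rfl fun r _ => ?_
  rw [Finset.sum_comm]
  refine Finset.sum_congr rfl fun a _ => Finset.sum_congr rfl fun r' _ =>
    Finset.sum_congr rfl fun a' _ => ?_
  ring

theorem trace_steeringMap_mul_maxEntangled (N X : Matrix (A × R) (A × R) ℂ) :
    (tensorId R (steeringMap N) X * maxEntangled R).trace =
      ((Fintype.card R : ℂ) ^ 2)⁻¹ * (X * N).trace := by
  have h : (N.transpose.submatrix Prod.swap Prod.swap *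
      X.transpose.submatrix Prod.swap Prod.swap : Matrix (R × A) (R × A) ℂ).trace =
        (X * N).trace := by
    rw [← Matrix.trace_transpose (X * N), Matrix.transpose_mul]
    exact trace_relabel_mul_relabel (Equiv.prodComm A R) _ _
  rw [trace_tensorId_mul_maxEntangled, choi_steeringMap, Matrix.smul_mul, Matrix.trace_smul,
    smul_eq_mul, h]
  ring

/-- By cyclicity the correction `W x` passes to the maximally entangled state, and from there to the
second factor as a transpose. It then commutes with the map on the first factor and reaches `X`. -/
theorem trace_tensorId_teleport_mul_maxEntangled (W : Fin (Fintype.card R ^ 2) → Matrix R R ℂ)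
    (M : Fin (Fintype.card R ^ 2) → Matrix (A × R) (A × R) ℂ) (X : Matrix (A × R) (A × R) ℂ) :
    (tensorId R (teleport W M) X * maxEntangled R).trace =
      ∑ x, ((Fintype.card R : ℂ) ^ 2)⁻¹ * (conjTransposeSnd (W x) X * M x).trace := by
  rw [tensorId_teleport, Finset.sum_mul, Matrix.trace_sum]
  refine Finset.sum_congr rfl fun x _ => ?_
  rw [← trace_steeringMap_mul_maxEntangled, tensorId_conjTransposeSnd, conjTransposeSnd]
  have h := kronecker_one_conj_maxEntangled (W x).conjTranspose
  have h1 : ((W x).conjTranspose ⊗ₖ (1 : Matrix R R ℂ)) =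
      (W x ⊗ₖ (1 : Matrix R R ℂ)).conjTranspose := by
    rw [Matrix.conjTranspose_kronecker, Matrix.conjTranspose_one]
  have h2 : ((1 : Matrix R R ℂ) ⊗ₖ (W x).conjTranspose.transpose) =
      ((1 : Matrix R R ℂ) ⊗ₖ (W x).transpose).conjTranspose := by
    rw [Matrix.conjTranspose_kronecker, Matrix.conjTranspose_one]
    rfl
  rw [h1, h2, Matrix.conjTranspose_conjTranspose, Matrix.conjTranspose_conjTranspose] at h
  rw [trace_conj_mul_comm, Matrix.trace_mul_comm, trace_conj_mul_comm,
    Matrix.trace_mul_comm _ (tensorId R _ X), ← h]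

/-- The uniform prior `d⁻²` is the product of two factors `d⁻¹`, one from the entangled resource of
the teleportation and one from the final overlap. -/
theorem successProb_pauliEnsemble [Nonempty R] {W : Fin (Fintype.card R ^ 2) → Matrix R R ℂ}
    (hW : IsPauliBasis W) {ρ : Matrix (A × R) (A × R) ℂ} (hρ : IsState ρ) (Ψ : SMap A B)
    (M : Fin (Fintype.card R ^ 2) → Matrix (B × R) (B × R) ℂ) :
    successProb (pauliEnsemble hW hρ).prob
      (fun x => tensorId R Ψ ((pauliEnsemble hW hρ).state x)) M =
        (tensorId R (teleport W M ∘ₗ Ψ) ρ * maxEntangled R).trace.re := by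
  rw [tensorId_comp, LinearMap.comp_apply, trace_tensorId_teleport_mul_maxEntangled, Complex.re_sum]
  refine Finset.sum_congr rfl fun x _ => ?_
  change _ * (tensorId R Ψ (conjTransposeSnd (W x) ρ) * M x).trace.re = _
  rw [tensorId_conjTransposeSnd, ← Complex.re_ofReal_mul]
  congr 2
  change ((((Fintype.card R : ℝ) ^ 2)⁻¹ : ℝ) : ℂ) = _
  push_cast
  rfl

/-- The Bell effect `x` carries the same rotation as the state `x`, so every `x` contributes the
same overlap. -/
theorem successProb_pauliEnsemble_bell [Nonempty R]
    {W : Fin (Fintype.card R ^ 2) → Matrix R R ℂ}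
    (hW : IsPauliBasis W) {ρ : Matrix (A × R) (A × R) ℂ} (hρ : IsState ρ) (Φ : SMap A R) :
    successProb (pauliEnsemble hW hρ).prob
      (fun x => tensorId R Φ ((pauliEnsemble hW hρ).state x)) (bell W) =
        (tensorId R Φ ρ * maxEntangled R).trace.re := by
  have h : ∀ x, (tensorId R Φ ((pauliEnsemble hW hρ).state x) * bell W x).trace =
      (tensorId R Φ ρ * maxEntangled R).trace := fun x => by
    rw [← trace_mul_bell hW _ x, ← tensorId_conjTransposeSnd]
    rfl
  simp only [successProb, h]
  rw [← Finset.sum_mul, (pauliEnsemble hW hρ).sum_prob, one_mul]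

end Teleportation

/-! ### The two directions of the comparison theorem -/

section Comparison

variable {𝔖 : Systems.{u, v, w}} {𝓒 : Processings 𝔖} {𝓜 : Measurements 𝔖} {A A' : 𝔖.Adm}

theorem successProb_adjointMap_eq {Q R U : Type*} {X Y : Type*} [Fintype X] [Fintype Y]
    [DecidableEq X] [Fintype R] [Fintype U] (Φ : SMap X Y) (α : SMap Q (U × X)) {k : ℕ}
    (lam : Fin k → ℝ) (ρ : Fin k → Matrix (Q × R) (Q × R) ℂ)
    (M : Fin k → Matrix ((U × Y) × R) ((U × Y) × R) ℂ) :
    successProb lam (fun i => tensorId R α (ρ i))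
      (fun i => tensorId R (idTensor U (adjointMap Φ)) (M i)) =
        successProb lam (fun i => tensorId R (idTensor U Φ ∘ₗ α) (ρ i)) M := by
  have h := ((isTraceAdjoint_adjointMap Φ).idTensor_left (U := U)).tensorId_right (R := R)
  simp only [successProb, ← h _ _]
  rfl

theorem le_restrictedSuccess {R : 𝔖.Adm} {k : ℕ} (E : Ensemble (𝔖.inp R × 𝔖.out R) k)
    (Φ : SMap (𝔖.inp A) (𝔖.out A)) {U : 𝔖.Anc}
    {α : SMap (𝔖.inp R) (𝔖.anc U × 𝔖.inp A)} (hα : α ∈ 𝓒.pre R U A)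
    {M : Fin k → Matrix ((𝔖.anc U × 𝔖.out A) × 𝔖.out R) ((𝔖.anc U × 𝔖.out A) × 𝔖.out R) ℂ}
    (hM : M ∈ 𝓜.meas U A R k) :
    ((successProb E.prob (fun i => tensorId (𝔖.out R) (idTensor (𝔖.anc U) Φ ∘ₗ α) (E.state i)) M :
      ℝ) : EReal) ≤ restrictedSuccess 𝓒 𝓜 A Φ R E := by
  rw [← successProb_adjointMap_eq]
  exact le_iSup_of_le U (le_iSup₂_of_le α hα (le_iSup₂_of_le M hM le_rfl))

theorem restrictedSuccess_le {R : 𝔖.Adm} {k : ℕ} {E : Ensemble (𝔖.inp R × 𝔖.out R) k}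
    {Φ : SMap (𝔖.inp A) (𝔖.out A)} {b : EReal}
    (h : ∀ U, ∀ α ∈ 𝓒.pre R U A, ∀ M ∈ 𝓜.meas U A R k,
      ((successProb E.prob
        (fun i => tensorId (𝔖.out R) (idTensor (𝔖.anc U) Φ ∘ₗ α) (E.state i)) M : ℝ) : EReal) ≤
          b) : restrictedSuccess 𝓒 𝓜 A Φ R E ≤ b := by
  refine iSup_le fun U => iSup₂_le fun α hα => iSup₂_le fun M hM => ?_
  rw [successProb_adjointMap_eq]
  exact h U α hα M hM

/-- A strategy for the guessing game with the channel `Θ(Φ)`, where `Θ` is an allowed superchannel,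
is a strategy for the game with `Φ`. -/
theorem successProb_superchannel_le_restrictedSuccess (h𝓜 : 𝓜.ClosedUnder 𝓒) {R : 𝔖.Adm} {k : ℕ}
    (E : Ensemble (𝔖.inp R × 𝔖.out R) k) (Φ : SMap (𝔖.inp A) (𝔖.out A)) {U V : 𝔖.Anc}
    {α : SMap (𝔖.inp A') (𝔖.anc V × 𝔖.inp A)} (hα : α ∈ 𝓒.pre A' V A)
    {β : SMap (𝔖.anc V × 𝔖.out A) (𝔖.out A')} (hβ : β ∈ 𝓒.post V A A')
    {α' : SMap (𝔖.inp R) (𝔖.anc U × 𝔖.inp A')} (hα' : α' ∈ 𝓒.pre R U A')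
    {M : Fin k → Matrix ((𝔖.anc U × 𝔖.out A') × 𝔖.out R) ((𝔖.anc U × 𝔖.out A') × 𝔖.out R) ℂ}
    (hM : M ∈ 𝓜.meas U A' R k) :
    ((successProb E.prob (fun i => tensorId (𝔖.out R)
      (idTensor (𝔖.anc U) (superchannel α β Φ) ∘ₗ α') (E.state i)) M : ℝ) : EReal) ≤
        restrictedSuccess 𝓒 𝓜 A Φ R E := by
  refine le_trans (le_of_eq ?_) (le_restrictedSuccess E Φ
    (𝓒.comp_mem_pre A A' R V U α hα α' hα') (h𝓜 A A' R V U k β hβ M hM))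
  have hadj := ((isTraceAdjoint_adjointMap β).idTensor_left (U := 𝔖.anc U)).tensorId_right
    (R := 𝔖.out R)
  congr 1
  refine Finset.sum_congr rfl fun i _ => ?_
  have h1 : tensorId (𝔖.out R) (idTensor (𝔖.anc (𝔖.mul U V)) Φ ∘ₗ
      relabel (𝔖.regroup U V (𝔖.inp A)) ∘ₗ idTensor (𝔖.anc U) α ∘ₗ α') (E.state i) =
      relabel (Equiv.prodCongr (𝔖.regroup U V (𝔖.out A)) (Equiv.refl (𝔖.out R)))
        (tensorId (𝔖.out R) (idTensor (𝔖.anc U) (idTensor (𝔖.anc V) Φ ∘ₗ α) ∘ₗ α')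
          (E.state i)) := by
    rfl
  dsimp only
  rw [h1, trace_relabel_mul_relabel, ← hadj]
  rfl

theorem superchannels_apply_isChannel {Φ : SMap (𝔖.inp A) (𝔖.out A)} (hΦ : IsChannel Φ)
    {Θ : SMap (𝔖.inp A) (𝔖.out A) →ₗ[ℂ] SMap (𝔖.inp A') (𝔖.out A')}
    (hΘ : Θ ∈ superchannels 𝔖 𝓒.pre 𝓒.post A A') : IsChannel (Θ Φ) := by
  obtain ⟨U, α, hα, β, hβ, rfl⟩ := hΘ
  exact (𝓒.pre_channel _ _ _ α hα).superchannel_apply (𝓒.post_channel _ _ _ β hβ) hΦ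

theorem restrictedSuccess_le_add_of_conversionDist_le (h𝓜 : 𝓜.ClosedUnder 𝓒)
    {Φ₁ : SMap (𝔖.inp A) (𝔖.out A)} (hΦ₁ : IsChannel Φ₁)
    {Φ₂ : SMap (𝔖.inp A') (𝔖.out A')} (hΦ₂ : IsChannel Φ₂) {ε : ℝ}
    (h : conversionDist 𝓒 A A' Φ₁ Φ₂ ≤ (ε : EReal)) (R : 𝔖.Adm) (k : ℕ)
    (E : Ensemble (𝔖.inp R × 𝔖.out R) k) :
    restrictedSuccess 𝓒 𝓜 A' Φ₂ R E ≤
      restrictedSuccess 𝓒 𝓜 A Φ₁ R E + ((ε / 2 * E.optSuccess : ℝ) : EReal) := by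
  refine restrictedSuccess_le fun U α' hα' M hM => ?_
  -- The infimum over superchannels need not be attained, so `Θ`, and with it `t`, depends on `c`;
  -- the limit `c → ε / 2` is taken at the end.
  have key : ∀ c : ℝ, ε / 2 < c → ∃ t : ℝ, (t : EReal) ≤ restrictedSuccess 𝓒 𝓜 A Φ₁ R E ∧
      successProb E.prob (fun i => tensorId (𝔖.out R) (idTensor (𝔖.anc U) Φ₂ ∘ₗ α')
        (E.state i)) M ≤ t + c * E.optSuccess := by
    intro c hc
    have hlt : conversionDist 𝓒 A A' Φ₁ Φ₂ < ((2 * c : ℝ) : EReal) :=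
      h.trans_lt (EReal.coe_lt_coe_iff.mpr (by linarith))
    simp only [conversionDist, iInf_lt_iff] at hlt
    obtain ⟨Θ, hΘ, hlt⟩ := hlt
    have hch := superchannels_apply_isChannel hΦ₁ hΘ
    obtain ⟨V, α, hα, β, hβ, rfl⟩ := hΘ
    exact ⟨_, successProb_superchannel_le_restrictedSuccess h𝓜 E Φ₁ hα hβ hα' hM,
      successProb_le_add_mul_optSuccess hΦ₂ hch (EReal.coe_lt_coe_iff.mp hlt)
        (𝓒.pre_channel _ _ _ α' hα') E (𝓜.isMeasurement _ _ _ _ M hM)⟩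
  generalize successProb E.prob (fun i => tensorId (𝔖.out R) (idTensor (𝔖.anc U) Φ₂ ∘ₗ α')
    (E.state i)) M = s at key ⊢
  generalize restrictedSuccess 𝓒 𝓜 A Φ₁ R E = r at key ⊢
  induction r with
  | bot =>
    obtain ⟨t, ht, -⟩ := key (ε / 2 + 1) (by linarith)
    exact absurd ht (by simp)
  | top =>
    rw [EReal.top_add_coe]
    exact le_top
  | coe r =>
    rw [← EReal.coe_add, EReal.coe_le_coe_iff]
    have hopt : ∀ c : ℝ, ε / 2 < c → s ≤ r + c * E.optSuccess := fun c hc => by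
      obtain ⟨t, ht, hs⟩ := key c hc
      have := EReal.coe_le_coe_iff.mp ht
      linarith
    have hlim : Filter.Tendsto (fun c : ℝ => r + c * E.optSuccess)
        (nhdsWithin (ε / 2) (Set.Ioi (ε / 2))) (nhds (r + ε / 2 * E.optSuccess)) :=
      ((by fun_prop : Continuous fun c : ℝ => r + c * E.optSuccess).tendsto _).mono_left
        nhdsWithin_le_nhds
    exact ge_of_tendsto hlim (Filter.eventually_of_mem self_mem_nhdsWithin hopt)

theorem convex_channels {X Y : Type*} [Fintype X] [Fintype Y] :
    Convex ℝ {γ : SMap X Y | IsChannel γ} := by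
  intro γ hγ γ' hγ' a b ha hb hab
  refine ⟨(hγ.1.smul ha).add (hγ'.1.smul hb), fun Z => ?_⟩
  change ((a : ℂ) • γ Z + (b : ℂ) • γ' Z).trace = _
  rw [Matrix.trace_add, Matrix.trace_smul, Matrix.trace_smul, hγ.2, hγ'.2, ← add_smul,
    ← Complex.ofReal_add, hab, Complex.ofReal_one, one_smul]

theorem exists_isState (X : Type*) [Fintype X] [Nonempty X] :
    ∃ ρ : Matrix X X ℂ, IsState ρ := by
  classical
  refine ⟨(Fintype.card X : ℂ)⁻¹ • 1, Matrix.PosSemidef.one.smul (by positivity), ?_⟩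
  rw [Matrix.trace_smul, Matrix.trace_one, smul_eq_mul, inv_mul_cancel₀ (by simp)]

/-- The guessing game for the ensembles generated by generalized Pauli unitaries compares the
overlaps of the output states with the maximally entangled state. -/
theorem overlap_le_of_restrictedSuccess_le {Φ₁ : SMap (𝔖.inp A) (𝔖.out A)}
    {Φ₂ : SMap (𝔖.inp A') (𝔖.out A')} {ε : ℝ} (hε : 0 ≤ ε)
    {W : Fin (Fintype.card (𝔖.out A') ^ 2) → Matrix (𝔖.out A') (𝔖.out A') ℂ} (hW : IsPauliBasis W)
    (hbell : (fun x => relabel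
        (Equiv.prodCongr (𝔖.unitor (𝔖.out A')) (Equiv.refl (𝔖.out A'))) (bell W x)) ∈
          𝓜.meas 𝔖.one A' A' (Fintype.card (𝔖.out A') ^ 2))
    (htel : ∀ (U : 𝔖.Anc), ∀ M ∈ 𝓜.meas U A A' (Fintype.card (𝔖.out A') ^ 2),
        teleport W M ∈ 𝓒.post U A A')
    (h : ∀ (k : ℕ) (E : Ensemble (𝔖.inp A' × 𝔖.out A') k),
        restrictedSuccess 𝓒 𝓜 A' Φ₂ A' E ≤
          restrictedSuccess 𝓒 𝓜 A Φ₁ A' E + ((ε / 2 * E.optSuccess : ℝ) : EReal))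
    {ρ : Matrix (𝔖.inp A' × 𝔖.out A') (𝔖.inp A' × 𝔖.out A') ℂ} (hρ : IsState ρ) :
    (superchannels 𝔖 𝓒.pre 𝓒.post A A').Nonempty ∧
    ∀ s : ℝ, (∀ Θ ∈ superchannels 𝔖 𝓒.pre 𝓒.post A A', ∀ γ, IsChannel γ →
      (tensorId (𝔖.out A') (Θ Φ₁ + (ε / 2 : ℂ) • γ) ρ * maxEntangled (𝔖.out A')).trace.re ≤ s) →
        (tensorId (𝔖.out A') Φ₂ ρ * maxEntangled (𝔖.out A')).trace.re ≤ s := by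
  set E := pauliEnsemble hW hρ
  have hlow : (((tensorId (𝔖.out A') Φ₂ ρ * maxEntangled (𝔖.out A')).trace.re : ℝ) : EReal) ≤
      restrictedSuccess 𝓒 𝓜 A' Φ₂ A' E := by
    rw [← successProb_pauliEnsemble_bell hW hρ]
    refine le_trans (le_of_eq ?_) (le_restrictedSuccess E Φ₂ (𝓒.id_mem_pre A') hbell)
    congr 1
    refine Finset.sum_congr rfl fun x _ => ?_
    have h1 : tensorId (𝔖.out A') (idTensor (𝔖.anc 𝔖.one) Φ₂ ∘ₗ
        relabel (𝔖.unitor (𝔖.inp A'))) (E.state x) =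
        relabel (Equiv.prodCongr (𝔖.unitor (𝔖.out A')) (Equiv.refl (𝔖.out A')))
          (tensorId (𝔖.out A') Φ₂ (E.state x)) := rfl
    dsimp only
    rw [h1, trace_relabel_mul_relabel]
  have hle := hlow.trans (h _ E)
  have hval : ∀ U, ∀ α ∈ 𝓒.pre A' U A, ∀ M ∈ 𝓜.meas U A A' (Fintype.card (𝔖.out A') ^ 2),
      ∃ Θ ∈ superchannels 𝔖 𝓒.pre 𝓒.post A A',
      successProb E.prob (fun i => tensorId (𝔖.out A') (idTensor (𝔖.anc U) Φ₁ ∘ₗ α) (E.state i)) M =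
        (tensorId (𝔖.out A') (Θ Φ₁) ρ * maxEntangled (𝔖.out A')).trace.re := by
    intro U α hα M hM
    exact ⟨superchannel α (teleport W M), ⟨U, α, hα, _, htel U M hM, rfl⟩,
      successProb_pauliEnsemble hW hρ _ M⟩
  constructor
  -- Every admissible pair `(α, M)` yields a superchannel. Without superchannels the right side of
  -- `(*)` is therefore `⊥`, whereas the Bell strategy bounds the left side below by a real number.
  · by_contra hempty
    have hbot : restrictedSuccess 𝓒 𝓜 A Φ₁ A' E ≤ ⊥ := by
      refine restrictedSuccess_le fun U α hα M hM => ?_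
      obtain ⟨Θ, hΘ, -⟩ := hval U α hα M hM
      exact absurd ⟨Θ, hΘ⟩ hempty
    rw [le_bot_iff.mp hbot, EReal.bot_add] at hle
    simp at hle
  · intro s hs
    have hs' : ∀ Θ ∈ superchannels 𝔖 𝓒.pre 𝓒.post A A', ∀ γ, IsChannel γ →
        (tensorId (𝔖.out A') (Θ Φ₁) ρ * maxEntangled (𝔖.out A')).trace.re +
          ε / 2 * (tensorId (𝔖.out A') γ ρ * maxEntangled (𝔖.out A')).trace.re ≤ s := by
      intro Θ hΘ γ hγ
      have := hs Θ hΘ γ hγ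
      rw [tensorId_add, tensorId_smul, LinearMap.add_apply, LinearMap.smul_apply, Matrix.add_mul,
        Matrix.smul_mul, Matrix.trace_add, Matrix.trace_smul, smul_eq_mul, Complex.add_re] at this
      have h2 : ((ε / 2 : ℂ)) = ((ε / 2 : ℝ) : ℂ) := by push_cast; rfl
      rwa [h2, Complex.re_ofReal_mul] at this
    -- Take `γ = teleport W N`: its overlap is the success probability of `N` on the ensemble. The
    -- supremum over `N` then produces `optSuccess`.
    have hup : ∀ N : Fin (Fintype.card (𝔖.out A') ^ 2) → Matrix (𝔖.inp A' × 𝔖.out A') _ ℂ,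
        IsMeasurement N → restrictedSuccess 𝓒 𝓜 A Φ₁ A' E ≤
          ((s - ε / 2 * successProb E.prob E.state N : ℝ) : EReal) := by
      intro N hN
      refine restrictedSuccess_le fun U α hα M hM => ?_
      obtain ⟨Θ, hΘ, heq⟩ := hval U α hα M hM
      rw [heq, EReal.coe_le_coe_iff]
      have h3 := hs' Θ hΘ _ (isChannel_teleport hW hN)
      have h4 : successProb E.prob E.state N = _ :=
        successProb_pauliEnsemble hW hρ LinearMap.id N
      rw [LinearMap.comp_id] at h4
      rw [h4]
      linarith
    -- Always guessing `i₀` is a measurement; it excludes the value `⊤` and shows that the supremum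
    -- defining `optSuccess` is over a nonempty set.
    set i₀ : Fin (Fintype.card (𝔖.out A') ^ 2) := ⟨0, by positivity⟩
    have hN₀ : IsMeasurement (A := 𝔖.inp A' × 𝔖.out A') (Pi.single i₀ 1) := by
      refine ⟨fun i => ?_, (Finset.sum_eq_single i₀ (fun j _ hj => Pi.single_eq_of_ne hj _)
        (by simp)).trans (Pi.single_eq_same _ _)⟩
      by_cases hi : i = i₀
      · rw [hi, Pi.single_eq_same]
        exact Matrix.PosSemidef.one
      · rw [Pi.single_eq_of_ne hi]
        exact Matrix.PosSemidef.zero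
    generalize restrictedSuccess 𝓒 𝓜 A Φ₁ A' E = r at hle hup
    induction r with
    | bot => rw [EReal.bot_add] at hle; simp at hle
    | top => exact absurd (top_le_iff.mp (hup _ hN₀)) (EReal.coe_ne_top _)
    | coe r =>
      rw [← EReal.coe_add, EReal.coe_le_coe_iff] at hle
      have hopt : ε / 2 * E.optSuccess ≤ s - r := by
        rw [Ensemble.optSuccess, ← smul_eq_mul, ← Real.sSup_smul_of_nonneg (by linarith)]
        refine csSup_le (Set.Nonempty.smul_set ⟨_, _, hN₀, rfl⟩) ?_
        rintro _ ⟨_, ⟨N, hN, rfl⟩, rfl⟩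
        have := EReal.coe_le_coe_iff.mp (hup N hN)
        change ε / 2 * _ ≤ _
        linarith
      linarith

theorem conversionDist_le_of_restrictedSuccess_le {Φ₁ : SMap (𝔖.inp A) (𝔖.out A)}
    (hΦ₁ : IsChannel Φ₁) {Φ₂ : SMap (𝔖.inp A') (𝔖.out A')} (hΦ₂ : IsChannel Φ₂) {ε : ℝ}
    (hε : 0 ≤ ε)
    {W : Fin (Fintype.card (𝔖.out A') ^ 2) → Matrix (𝔖.out A') (𝔖.out A') ℂ} (hW : IsPauliBasis W)
    (hbell : (fun x => relabel
        (Equiv.prodCongr (𝔖.unitor (𝔖.out A')) (Equiv.refl (𝔖.out A'))) (bell W x)) ∈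
          𝓜.meas 𝔖.one A' A' (Fintype.card (𝔖.out A') ^ 2))
    (htel : ∀ (U : 𝔖.Anc), ∀ M ∈ 𝓜.meas U A A' (Fintype.card (𝔖.out A') ^ 2),
        teleport W M ∈ 𝓒.post U A A')
    (h : ∀ (k : ℕ) (E : Ensemble (𝔖.inp A' × 𝔖.out A') k),
        restrictedSuccess 𝓒 𝓜 A' Φ₂ A' E ≤
          restrictedSuccess 𝓒 𝓜 A Φ₁ A' E + ((ε / 2 * E.optSuccess : ℝ) : EReal)) :
    conversionDist 𝓒 A A' Φ₁ Φ₂ ≤ (ε : EReal) := by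
  set d : ℝ := (Fintype.card (𝔖.out A') : ℝ) with hd
  have hdpos : 0 < d := by positivity
  set C : Set (Matrix (𝔖.out A' × 𝔖.inp A') (𝔖.out A' × 𝔖.inp A') ℂ) :=
    {k | ∃ Θ ∈ superchannels 𝔖 𝓒.pre 𝓒.post A A', ∃ γ, IsChannel γ ∧
      k = choi (Θ Φ₁ + (ε / 2 : ℂ) • γ)} with hC
  have hε2 : (ε / 2 : ℂ) = ((ε / 2 : ℝ) : ℂ) := by push_cast; rfl
  have hne : C.Nonempty := by
    obtain ⟨ρ, hρ⟩ := exists_isState (𝔖.inp A' × 𝔖.out A')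
    obtain ⟨Θ, hΘ⟩ := (overlap_le_of_restrictedSuccess_le hε hW hbell htel h hρ).1
    exact ⟨_, Θ, hΘ, Φ₂, hΦ₂, rfl⟩
  have hconv : Convex ℝ C := by
    rintro _ ⟨Θ, hΘ, γ, hγ, rfl⟩ _ ⟨Θ', hΘ', γ', hγ', rfl⟩ a b ha hb hab
    refine ⟨a • Θ + b • Θ', 𝓒.convex A A' hΘ hΘ' ha hb hab, a • γ + b • γ',
      convex_channels hγ hγ' ha hb hab, ?_⟩
    have h1 : (a • Θ + b • Θ') Φ₁ = (a : ℂ) • Θ Φ₁ + (b : ℂ) • Θ' Φ₁ := rfl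
    have h2 : a • γ + b • γ' = (a : ℂ) • γ + (b : ℂ) • γ' := rfl
    rw [h1, h2, ← Complex.coe_smul, ← Complex.coe_smul, ← map_smul, ← map_smul, ← map_add]
    congr 1
    module
  have hherm : ∀ k ∈ C, k.IsHermitian := by
    rintro _ ⟨Θ, hΘ, γ, hγ, rfl⟩
    rw [hε2]
    exact ((superchannels_apply_isChannel hΦ₁ hΘ).1.add
      (hγ.1.smul (by linarith))).choi_posSemidef.1
  have hdual : ∀ X : Matrix (𝔖.out A' × 𝔖.inp A') (𝔖.out A' × 𝔖.inp A') ℂ, X.PosSemidef →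
      ∀ s : ℝ, (∀ k ∈ C, (X * k).trace.re ≤ s) → (X * choi Φ₂).trace.re ≤ s := by
    intro X hX s hs
    -- `X = 0` cannot be normalized to a state; there `0 ≤ s` follows from the nonemptiness of `C`.
    rcases eq_or_ne X 0 with rfl | hX0
    · obtain ⟨k, hk⟩ := hne
      simpa using hs k hk
    obtain ⟨t, ht, htX⟩ : ∃ t : ℝ, 0 < t ∧ X.trace = (t : ℂ) := by
      have h1 : 0 < X.trace := lt_of_le_of_ne hX.trace_nonneg
        fun h0 => hX0 (hX.trace_eq_zero_iff.mp h0.symm)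
      obtain ⟨htre, htim⟩ := Complex.pos_iff.mp h1
      exact ⟨_, htre, Complex.ext rfl (by simpa using htim.symm)⟩
    set ρ : Matrix (𝔖.inp A' × 𝔖.out A') (𝔖.inp A' × 𝔖.out A') ℂ :=
      ((t⁻¹ : ℝ) : ℂ) • X.transpose.submatrix Prod.swap Prod.swap with hρdef
    have hρ : IsState ρ := by
      refine ⟨(hX.transpose.submatrix _).smul
        (Complex.zero_le_real.mpr (inv_nonneg.mpr ht.le)), ?_⟩
      have h1 : (X.transpose.submatrix Prod.swap Prod.swap :
          Matrix (𝔖.inp A' × 𝔖.out A') (𝔖.inp A' × 𝔖.out A') ℂ).trace = X.trace :=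
        Equiv.sum_comp (Equiv.prodComm _ _) fun p => X p p
      rw [Matrix.trace_smul, h1, htX, smul_eq_mul, ← Complex.ofReal_mul, inv_mul_cancel₀ ht.ne',
        Complex.ofReal_one]
    have hov : ∀ Ψ : SMap (𝔖.inp A') (𝔖.out A'),
        (tensorId (𝔖.out A') Ψ ρ * maxEntangled (𝔖.out A')).trace.re =
          (d⁻¹ * t⁻¹) * (X * choi Ψ).trace.re := by
      intro Ψ
      have h1 : ρ.transpose.submatrix Prod.swap Prod.swap = ((t⁻¹ : ℝ) : ℂ) • X := rfl
      rw [trace_tensorId_mul_maxEntangled, h1, Matrix.mul_smul, Matrix.trace_smul, smul_eq_mul,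
        Matrix.trace_mul_comm, ← Complex.re_ofReal_mul, hd, ← mul_assoc]
      push_cast
      rfl
    have hpos : 0 < d⁻¹ * t⁻¹ := by positivity
    have h2 := (overlap_le_of_restrictedSuccess_le hε hW hbell htel h hρ).2 (d⁻¹ * t⁻¹ * s)
      fun Θ hΘ γ hγ => by
        rw [hov]
        exact mul_le_mul_of_nonneg_left (hs _ ⟨Θ, hΘ, γ, hγ, rfl⟩) hpos.le
    rw [hov] at h2
    exact le_of_mul_le_mul_left h2 hpos
  refine EReal.le_of_forall_lt_iff_le.mp fun z hz => ?_
  have hz' : ε < z := EReal.coe_lt_coe_iff.mp hz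
  -- Solves `2 * (ε / 2 + η * d) = z`, where `d` is the trace factor of the map with Choi matrix
  -- `1`, which absorbs the error `η • 1`.
  set η : ℝ := (z - ε) / (2 * d) with hη
  have hηpos : 0 < η := div_pos (by linarith) (by linarith)
  obtain ⟨_, ⟨Θ, hΘ, γ, hγ, rfl⟩, hk⟩ := exists_mem_convex_posSemidef_add_smul_one_sub hconv hne
    hherm hΦ₂.1.choi_posSemidef.1 hdual hηpos
  refine iInf₂_le_of_le Θ hΘ (EReal.coe_le_coe_iff.mpr ?_)
  have hΘch := superchannels_apply_isChannel hΦ₁ hΘ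
  set T : SMap (𝔖.inp A') (𝔖.out A') := ofChoi 1
  have hT : IsCompletelyPositive T :=
    isCompletelyPositive_of_choi (by rw [choi_ofChoi]; exact Matrix.PosSemidef.one)
  have hTtr : ∀ X, (T X).trace = (d : ℂ) * X.trace := by
    intro X
    rw [trace_apply_eq_sum, choi_ofChoi, ← Matrix.one_kronecker_one, partialTraceFst_one_kronecker]
    simp [Matrix.one_apply, Matrix.trace, Finset.mul_sum, hd, mul_comm]
  have hc : 0 ≤ ε / 2 + η * d := by positivity
  have hfin := diamondNorm_le_of_le (Δ := Φ₂ - Θ Φ₁)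
    (Λ := ((ε / 2 : ℝ) : ℂ) • γ + ((η : ℝ) : ℂ) • T) (c := ε / 2 + η * d) hc
    (fun X => by rw [LinearMap.sub_apply, Matrix.trace_sub, hΦ₂.2, hΘch.2, sub_self])
    ((hγ.1.smul (by linarith)).add (hT.smul hηpos.le))
    (fun X => by
      rw [LinearMap.add_apply, LinearMap.smul_apply, LinearMap.smul_apply, Matrix.trace_add,
        Matrix.trace_smul, Matrix.trace_smul, hTtr, hγ.2]
      simp only [smul_eq_mul]
      push_cast
      ring)
    (isCompletelyPositive_of_choi (by
      refine (congrArg Matrix.PosSemidef ?_).mpr hk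
      rw [map_sub, map_add, map_smul, map_smul, map_sub, choi_ofChoi, map_add, map_smul, hε2]
      abel))
  rw [diamondNorm_sub_comm]
  refine hfin.trans (le_of_eq ?_)
  rw [hη]
  field_simp
  ring

end Comparison

end ChannelComparison

theorem theorem4 (𝔖 : Systems.{u, v, w}) (𝓒 : Processings 𝔖) (𝓜 : Measurements 𝔖)
    (h𝓜 : 𝓜.ClosedUnder 𝓒) (A A' : 𝔖.Adm)
    (Φ₁ : SMap (𝔖.inp A) (𝔖.out A)) (hΦ₁ : IsChannel Φ₁)
    (Φ₂ : SMap (𝔖.inp A') (𝔖.out A')) (hΦ₂ : IsChannel Φ₂)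
    (ε : ℝ) (hε : 0 ≤ ε) :
    (conversionDist 𝓒 A A' Φ₁ Φ₂ ≤ (ε : EReal) →
      ∀ (R : 𝔖.Adm) (k : ℕ) (E : Ensemble (𝔖.inp R × 𝔖.out R) k),
        restrictedSuccess 𝓒 𝓜 A' Φ₂ R E ≤
          restrictedSuccess 𝓒 𝓜 A Φ₁ R E + ((ε / 2 * E.optSuccess : ℝ) : EReal)) ∧
    (∀ W : Fin (Fintype.card (𝔖.out A') ^ 2) → Matrix (𝔖.out A') (𝔖.out A') ℂ, IsPauliBasis W →
      (fun x => relabel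
        (Equiv.prodCongr (𝔖.unitor (𝔖.out A')) (Equiv.refl (𝔖.out A'))) (bell W x)) ∈
          𝓜.meas 𝔖.one A' A' (Fintype.card (𝔖.out A') ^ 2) →
      (∀ (U : 𝔖.Anc), ∀ M ∈ 𝓜.meas U A A' (Fintype.card (𝔖.out A') ^ 2),
        teleport W M ∈ 𝓒.post U A A') →
      (∀ (k : ℕ) (E : Ensemble (𝔖.inp A' × 𝔖.out A') k),
        restrictedSuccess 𝓒 𝓜 A' Φ₂ A' E ≤
          restrictedSuccess 𝓒 𝓜 A Φ₁ A' E + ((ε / 2 * E.optSuccess : ℝ) : EReal)) →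
      conversionDist 𝓒 A A' Φ₁ Φ₂ ≤ (ε : EReal)) := by
  exact ⟨fun h R k E => restrictedSuccess_le_add_of_conversionDist_le h𝓜 hΦ₁ hΦ₂ h R k E,
    fun W hW hbell htel h =>
      conversionDist_le_of_restrictedSuccess_le hΦ₁ hΦ₂ hε hW hbell htel h⟩
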